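/- For $\gamma>-1$ (and $\gamma<2$ in the first two lines) and $x\in\mathbb R$ put $$\mathrm{Ai}_\gamma(x)=\frac1\pi\int_0^\infty\sigma^\gamma\cos\Big(\frac{\sigma^3}3+x\sigma-\frac{\gamma\pi}2\Big)d\sigma,$$ $$\mathrm{Gi}_\gamma(x)=\frac1\pi\int_0^\infty\sigma^\gamma\sin\Big(\frac{\sigma^3}3+x\sigma-\frac{\gamma\pi}2\Big)d\sigma,$$ $$\mathrm{Hi}_\gamma(x)=\frac1\pi\int_0^\infty\sigma^\gamma e^{-\sigma^3/3+x\sigma}\,d\sigma,$$ where the first two integrals are (conditionally convergent) improper Riemann integrals $\lim_{R\to\infty}\int_0^R$. Let $-1<\gamma<0$ and $L_\gamma u=(1+\gamma)u+xu_x-u_{xxx}$. Let $C_c(\mathbb R)$ be the space of real-valued continuous compactly supported functions on $\mathbb R$, and let $X_0$ be the space of all $u\in C^1(\mathbb R)$ with $$\sup_{x\in\mathbb R}\Big((1+|x|)^{1+\gamma}|u(x)|+(1+|x|)^{2+\gamma}|u_x(x)|\Big)<\infty .$$ Then there is exactly one map $T_\gamma:C_c(\mathbb R)\to X_0$ that is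 a right inverse of $L_\gamma$, i.e. such that $L_\gamma T_\gamma f=f$ in the sense of distributions for all $f\in C_c(\mathbb R)$. This map is linear, $T_\gamma f$ is of class $C^3$ and satisfies $L_\gamma T_\gamma f=f$ pointwise, and $T_\gamma f(x)=\int_{\mathbb R}K_\gamma(x,y)f(y)\,dy$ with an integrable integrand for all $x\in\mathbb R$, where $$\begin{aligned}K_\gamma(x,y)=\;&\pi\Big(\mathrm{Ai}_{-1-\gamma}(y)\,\mathrm{Hi}_\gamma(x)\,\chi_{x<y}-\mathrm{Hi}_{-1-\gamma}(y)\,\mathrm{Ai}_\gamma(x)\,\chi_{y<x}\Big)\\&-\pi\sin(\gamma\pi)\Big(\mathrm{Gi}_{-1-\gamma}(y)\,\mathrm{Gi}_\gamma(x)+\mathrm{Ai}_{-1-\gamma}(y)\,\mathrm{Ai}_\gamma(x)\Big)\chi_{y<x}\\&-\pi\cos(\gamma\pi)\Big(\mathrm{Ai}_{-1-\gamma}(y)\,\mathrm{Gi}_\gamma(x)-\mathrm{Gi}_{-1-\gamma}(y)\,\mathrm{Ai}_\gamma(x)\Big)\chi_{y<x}.\end{aligned}$$ -/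

import Mathlib

open MeasureTheory Filter
open scoped CompactlySupported ContDiff

noncomputable section

/-- The generalized Airy function
`Ai_γ(x) = (1/π) ∫_0^∞ σ^γ cos(σ³/3 + xσ - γπ/2) dσ`, the integral being the (conditionally
convergent) improper integral; it converges for `-1 < γ < 2`. -/
def genAi (γ x : ℝ) : ℝ :=
  (1 / Real.pi) * limUnder atTop (fun R : ℝ =>
    ∫ σ in (0 : ℝ)..R, σ ^ γ * Real.cos (σ ^ 3 / 3 + x * σ - γ * Real.pi / 2))

/-- The generalized Scorer function of the first kind
`Gi_γ(x) = (1/π) ∫_0^∞ σ^γ sin(σ³/3 + xσ - γπ/2) dσ` (improper integral, `-1 < γ < 2`). -/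
def genGi (γ x : ℝ) : ℝ :=
  (1 / Real.pi) * limUnder atTop (fun R : ℝ =>
    ∫ σ in (0 : ℝ)..R, σ ^ γ * Real.sin (σ ^ 3 / 3 + x * σ - γ * Real.pi / 2))

/-- The generalized Scorer function of the second kind
`Hi_γ(x) = (1/π) ∫_0^∞ σ^γ exp(-σ³/3 + xσ) dσ` (absolutely convergent for `γ > -1`). -/
def genHi (γ x : ℝ) : ℝ :=
  (1 / Real.pi) * ∫ σ in Set.Ioi (0 : ℝ), σ ^ γ * Real.exp (-(σ ^ 3 / 3) + x * σ)

/-- The integral kernel `K_γ(x, y)`, explicit in terms of `Ai`, `Gi`, `Hi` with index `γ` at `x`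
and index `-1 - γ` at `y`. Its value on the diagonal is immaterial. -/
def greenKernel (γ x y : ℝ) : ℝ :=
  if x < y then Real.pi * (genAi (-1 - γ) y * genHi γ x)
  else if y < x then
    -(Real.pi * (genHi (-1 - γ) y * genAi γ x))
    - Real.pi * Real.sin (γ * Real.pi) *
        (genGi (-1 - γ) y * genGi γ x + genAi (-1 - γ) y * genAi γ x)
    - Real.pi * Real.cos (γ * Real.pi) *
        (genAi (-1 - γ) y * genGi γ x - genGi (-1 - γ) y * genAi γ x)
  else 0

/-- The differential operator `L_γ u = (1+γ) u + x u' - u'''`. -/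
def opL (γ : ℝ) (u : ℝ → ℝ) (x : ℝ) : ℝ :=
  (1 + γ) * u x + x * deriv u x - iteratedDeriv 3 u x

/-- `L_γ u = f` in the sense of distributions: for every test function `φ`,
`∫ u ((1+γ) φ - (x φ)' + φ''') = ∫ f φ`. -/
def WeakEqL (γ : ℝ) (u f : ℝ → ℝ) : Prop :=
  ∀ φ : ℝ → ℝ, ContDiff ℝ ∞ φ → HasCompactSupport φ →
    ∫ x, u x * ((1 + γ) * φ x - deriv (fun t => t * φ t) x + iteratedDeriv 3 φ x)
      = ∫ x, f x * φ x

/-- The space `X_0`: all `C^1` functions `u : ℝ → ℝ` with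
`sup_x ((1+|x|)^(1+γ) |u(x)| + (1+|x|)^(2+γ) |u'(x)|) < ∞`. -/
def spaceX (γ : ℝ) : Submodule ℝ (ℝ → ℝ) where
  carrier := {u | ContDiff ℝ 1 u ∧ BddAbove (Set.range fun x : ℝ =>
    (1 + |x|) ^ (1 + γ) * |u x| + (1 + |x|) ^ (2 + γ) * |deriv u x|)}
  zero_mem' := by
    refine ⟨contDiff_const, 0, ?_⟩
    rintro _ ⟨x, rfl⟩
    have h : deriv (0 : ℝ → ℝ) x = 0 := deriv_const x (0 : ℝ)
    simp [h]
  add_mem' := by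
    rintro u v ⟨hu, C, hC⟩ ⟨hv, D, hD⟩
    refine ⟨hu.add hv, C + D, ?_⟩
    rintro _ ⟨x, rfl⟩
    have hx := hC ⟨x, rfl⟩
    have hy := hD ⟨x, rfl⟩
    have hd : deriv (u + v) x = deriv u x + deriv v x :=
      deriv_add (hu.differentiable one_ne_zero x) (hv.differentiable one_ne_zero x)
    have p : 0 ≤ (1 + |x|) ^ (1 + γ) := by positivity
    have q : 0 ≤ (1 + |x|) ^ (2 + γ) := by positivity
    have h1 := mul_le_mul_of_nonneg_left (abs_add_le (u x) (v x)) p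
    have h2 := mul_le_mul_of_nonneg_left (abs_add_le (deriv u x) (deriv v x)) q
    simp only [Pi.add_apply, hd] at *
    linarith
  smul_mem' := by
    rintro c u ⟨hu, C, hC⟩
    refine ⟨hu.const_smul c, |c| * C, ?_⟩
    rintro _ ⟨x, rfl⟩
    have hx := mul_le_mul_of_nonneg_left (hC ⟨x, rfl⟩) (abs_nonneg c)
    have hd : deriv (c • u) x = c * deriv u x := by
      simpa using deriv_const_smul c (hu.differentiable one_ne_zero x)
    simp only [Pi.smul_apply, smul_eq_mul, hd, abs_mul] at *
    linarith

/-- `T` is a right inverse of `L_γ` on the compactly supported continuous functions: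
`L_γ (T f) = f` for all `f`. Elements of `X_0` are only `C^1`, so the equation is taken in the
sense of distributions. -/
def IsRightInverseL (γ : ℝ) (T : C_c(ℝ, ℝ) → spaceX γ) : Prop :=
  ∀ f : C_c(ℝ, ℝ), WeakEqL γ (T f : ℝ → ℝ) f

end

/-!
For `d³ = 1` the function `u(x) = F_γ(d x)`, where `F_γ(z) = ∫_0^∞ t^γ exp (-t³/3 + z t) dt`, solves
`L_γ u = 0`. Rotating the path of integration to `arg z = π/6` shows that `Ai_γ`, `Gi_γ`, `Hi_γ`
are real parts of constant multiples of such functions, and these decay like `|x|^(-1-γ)` on the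
half-line where `Re (d x) < 0`. The formal adjoint of `L_γ` annihilates the solutions of index
`-1 - γ`, so the concomitants of the two triples of solutions are constant; their values at `0` are
given by Gamma's reflection formula. They make the kernel the one produced by variation of
constants, each solution being paired with an integral that vanishes on the side where it does not
decay.

Uniqueness is seen on the Fourier side: if `u ∈ X_0` and `L_γ u = 0`, then `𝓕 u'` is continuous,
tends to zero at infinity, and solves a first-order equation on `0 < v`, whose solutions are
multiples of `v^(1+γ) exp (8π³ i v³/3)`. Such a function does not tend to zero unless it vanishes.
-/

noncomputable section

open Set Topology
open scoped Real SchwartzMap FourierTransform Pointwise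

/-! ### The Laplace-type integral -/

/-- The integrand of `airyLaplace`. -/
def airyIntegrand (γ : ℝ) (z : ℂ) (t : ℝ) : ℂ :=
  ((t ^ γ : ℝ) : ℂ) * Complex.exp (-((t ^ 3 / 3 : ℝ) : ℂ) + z * t)

/-- The entire function `F_γ(z) = ∫_0^∞ t^γ exp (-t³/3 + z t) dt`. All of `Ai_γ`, `Gi_γ`, `Hi_γ`
are real parts of constant multiples of `x ↦ F_γ(d x)` with `d` a cube root of unity. -/
def airyLaplace (γ : ℝ) (z : ℂ) : ℂ :=
  ∫ t in Ioi (0 : ℝ), airyIntegrand γ z t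

theorem norm_airyIntegrand (γ : ℝ) (z : ℂ) {t : ℝ} (ht : 0 ≤ t) :
    ‖airyIntegrand γ z t‖ = t ^ γ * Real.exp (-(t ^ 3 / 3) + z.re * t) := by
  rw [airyIntegrand, norm_mul, Complex.norm_real, Real.norm_of_nonneg (Real.rpow_nonneg ht _),
    Complex.norm_exp, Complex.add_re, Complex.neg_re, Complex.ofReal_re, Complex.re_mul_ofReal]

theorem neg_cube_add_mul_le {t M : ℝ} (ht : 0 ≤ t) (hM : 0 ≤ M) :
    -(t ^ 3 / 3) + M * t ≤ 2 * (M + 1) ^ 3 / 3 - t := by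
  have h : 0 ≤ (t - (M + 1)) ^ 2 * (t + 2 * (M + 1)) := by positivity
  have h' : 0 ≤ t * (M * (M + 1)) := by positivity
  linarith

theorem norm_airyIntegrand_le (γ : ℝ) {z : ℂ} {M t : ℝ} (ht : 0 ≤ t) (hM : 0 ≤ M)
    (hz : z.re ≤ M) :
    ‖airyIntegrand γ z t‖ ≤ Real.exp (2 * (M + 1) ^ 3 / 3) * (t ^ γ * Real.exp (-t)) := by
  rw [norm_airyIntegrand γ z ht, mul_left_comm, ← Real.exp_add]
  refine mul_le_mul_of_nonneg_left (Real.exp_le_exp.2 ?_) (Real.rpow_nonneg ht _)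
  linarith [neg_cube_add_mul_le ht hM, mul_le_mul_of_nonneg_right hz ht]

theorem integrableOn_rpow_mul_exp_neg {γ : ℝ} (hγ : -1 < γ) :
    IntegrableOn (fun t : ℝ => t ^ γ * Real.exp (-t)) (Ioi 0) := by
  refine (Real.GammaIntegral_convergent (s := γ + 1) (by linarith)).congr_fun
    (fun t _ => ?_) measurableSet_Ioi
  simp only [add_sub_cancel_right, mul_comm]

theorem aestronglyMeasurable_airyIntegrand (γ : ℝ) (z : ℂ) :
    AEStronglyMeasurable (airyIntegrand γ z) (volume.restrict (Ioi 0)) := by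
  refine ContinuousOn.aestronglyMeasurable (ContinuousOn.mul ?_ (by fun_prop)) measurableSet_Ioi
  exact Complex.continuous_ofReal.comp_continuousOn
    (continuousOn_id.rpow_const fun t ht => Or.inl (ne_of_gt ht))

theorem integrableOn_airyIntegrand {γ : ℝ} (hγ : -1 < γ) (z : ℂ) :
    IntegrableOn (airyIntegrand γ z) (Ioi 0) := by
  refine Integrable.mono' ((integrableOn_rpow_mul_exp_neg hγ).const_mul
    (Real.exp (2 * (|z.re| + 1) ^ 3 / 3))) (aestronglyMeasurable_airyIntegrand γ z) ?_
  filter_upwards [ae_restrict_mem measurableSet_Ioi] with t ht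
  exact norm_airyIntegrand_le γ (le_of_lt ht) (abs_nonneg _) (le_abs_self _)

theorem hasDerivAt_airyIntegrand_left (γ : ℝ) (z : ℂ) {t : ℝ} (ht : 0 < t) :
    HasDerivAt (fun w => airyIntegrand γ w t) (airyIntegrand (γ + 1) z t) z := by
  have h_phase : HasDerivAt (fun w : ℂ => -((t ^ 3 / 3 : ℝ) : ℂ) + w * t) (t : ℂ) z := by
    simpa using ((hasDerivAt_id z).mul_const (t : ℂ)).const_add (-((t ^ 3 / 3 : ℝ) : ℂ))
  refine (h_phase.cexp.const_mul ((t ^ γ : ℝ) : ℂ)).congr_deriv ?_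
  simp only [airyIntegrand, Real.rpow_add_one ht.ne']
  push_cast
  ring

theorem hasDerivAt_airyLaplace {γ : ℝ} (hγ : -1 < γ) (z : ℂ) :
    HasDerivAt (airyLaplace γ) (airyLaplace (γ + 1) z) z := by
  refine (hasDerivAt_integral_of_dominated_loc_of_deriv_le (Metric.ball_mem_nhds z one_pos)
    (Eventually.of_forall fun w => aestronglyMeasurable_airyIntegrand γ w)
    (integrableOn_airyIntegrand hγ z) (aestronglyMeasurable_airyIntegrand (γ + 1) z)
    (bound := fun t => Real.exp (2 * (|z.re| + 1 + 1) ^ 3 / 3) * (t ^ (γ + 1) * Real.exp (-t)))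
    ?_ ((integrableOn_rpow_mul_exp_neg (by linarith)).const_mul _) ?_).2
  · filter_upwards [ae_restrict_mem measurableSet_Ioi] with t ht w hw
    refine norm_airyIntegrand_le _ (le_of_lt ht) (by positivity) ?_
    have h_re : |w.re - z.re| ≤ ‖w - z‖ := by simpa using Complex.abs_re_le_norm (w - z)
    linarith [mem_ball_iff_norm.1 hw, le_abs_self (w.re - z.re), le_abs_self z.re]
  · filter_upwards [ae_restrict_mem measurableSet_Ioi] with t ht w _
    exact hasDerivAt_airyIntegrand_left γ w ht

theorem hasDerivAt_ofReal_rpow_add_one (s : ℝ) {t : ℝ} (ht : 0 < t) :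
    HasDerivAt (fun t : ℝ => ((t ^ (s + 1) : ℝ) : ℂ)) (((s + 1) * t ^ s : ℝ) : ℂ) t := by
  simpa using (Real.hasDerivAt_rpow_const (p := s + 1) (Or.inl ht.ne')).ofReal_comp

theorem hasDerivAt_airyIntegrand_right (γ : ℝ) (z : ℂ) {t : ℝ} (ht : 0 < t) :
    HasDerivAt (airyIntegrand (γ + 1) z)
      ((γ + 1) * airyIntegrand γ z t + z * airyIntegrand (γ + 1) z t
        - airyIntegrand (γ + 3) z t) t := by
  have h_cube : HasDerivAt (fun t : ℝ => t ^ 3 / 3) (t ^ 2) t := by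
    simpa using (hasDerivAt_pow 3 t).div_const 3
  have h_phase : HasDerivAt (fun t : ℝ => -((t ^ 3 / 3 : ℝ) : ℂ) + z * t)
      (-((t ^ 2 : ℝ) : ℂ) + z * 1) t :=
    h_cube.ofReal_comp.fun_neg.fun_add ((hasDerivAt_id t).ofReal_comp.const_mul z)
  refine ((hasDerivAt_ofReal_rpow_add_one γ ht).fun_mul h_phase.cexp).congr_deriv ?_
  have h_pow : t ^ (γ + 3) = t ^ γ * t ^ 3 := by exact_mod_cast Real.rpow_add_natCast ht.ne' γ 3
  simp only [airyIntegrand, h_pow, Real.rpow_add_one ht.ne']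
  push_cast
  ring

theorem tendsto_airyIntegrand_atTop (γ : ℝ) (z : ℂ) :
    Tendsto (airyIntegrand γ z) atTop (𝓝 0) := by
  refine squeeze_zero_norm' (a := fun t => Real.exp (2 * (|z.re| + 1) ^ 3 / 3) *
    (t ^ γ * Real.exp (-t))) ?_ ?_
  · filter_upwards [eventually_ge_atTop 0] with t ht
    exact norm_airyIntegrand_le _ ht (abs_nonneg _) (le_abs_self _)
  · simpa using (tendsto_rpow_mul_exp_neg_mul_atTop_nhds_zero γ 1 one_pos).const_mul
      (Real.exp (2 * (|z.re| + 1) ^ 3 / 3))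

theorem airyLaplace_add_three {γ : ℝ} (hγ : -1 < γ) (z : ℂ) :
    airyLaplace (γ + 3) z = z * airyLaplace (γ + 1) z + (γ + 1) * airyLaplace γ z := by
  have h_int₀ := (integrableOn_airyIntegrand hγ z).const_mul ((γ : ℂ) + 1)
  have h_int₁ := (integrableOn_airyIntegrand (γ := γ + 1) (by linarith) z).const_mul z
  have h_int₃ := integrableOn_airyIntegrand (γ := γ + 3) (by linarith) z
  have h_zero : airyIntegrand (γ + 1) z 0 = 0 := by
    simp [airyIntegrand, Real.zero_rpow (show γ + 1 ≠ 0 by linarith)]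
  have h_cont : Continuous (airyIntegrand (γ + 1) z) :=
    (Complex.continuous_ofReal.comp (Real.continuous_rpow_const (by linarith))).mul (by fun_prop)
  have h_ftc := integral_Ioi_of_hasDerivAt_of_tendsto h_cont.continuousWithinAt
    (fun t ht => hasDerivAt_airyIntegrand_right γ z ht) ((h_int₀.add h_int₁).sub h_int₃)
    (tendsto_airyIntegrand_atTop (γ + 1) z)
  rw [h_zero, sub_zero, integral_sub (h_int₀.fun_add h_int₁) h_int₃, integral_add h_int₀ h_int₁,
    integral_const_mul, integral_const_mul] at h_ftc
  simp only [airyLaplace]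
  linear_combination -h_ftc

theorem norm_airyLaplace_le {γ : ℝ} (hγ : -1 < γ) {z : ℂ} {m : ℝ} (hm : 0 < m)
    (hz : z.re ≤ -m) : ‖airyLaplace γ z‖ ≤ Real.Gamma (γ + 1) * m ^ (-(1 + γ)) := by
  have h_Gamma := Real.integral_rpow_mul_exp_neg_mul_Ioi (a := γ + 1) (r := m) (by linarith) hm
  have h_pow : (1 / m) ^ (γ + 1) = m ^ (-(1 + γ)) := by
    rw [one_div, Real.inv_rpow hm.le, ← Real.rpow_neg hm.le, add_comm]
  rw [h_pow, mul_comm, add_sub_cancel_right] at h_Gamma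
  have h_pos : 0 < Real.Gamma (γ + 1) * m ^ (-(1 + γ)) :=
    mul_pos (Real.Gamma_pos_of_pos (by linarith)) (Real.rpow_pos_of_pos hm _)
  rw [← h_Gamma] at h_pos ⊢
  refine norm_integral_le_of_norm_le (Integrable.of_integral_ne_zero h_pos.ne') ?_
  filter_upwards [ae_restrict_mem measurableSet_Ioi] with t (ht : 0 < t)
  rw [norm_airyIntegrand γ z ht.le]
  refine mul_le_mul_of_nonneg_left (Real.exp_le_exp.2 ?_) (Real.rpow_nonneg ht.le _)
  linarith [mul_le_mul_of_nonneg_right hz ht.le, show 0 ≤ t ^ 3 / 3 by positivity]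

theorem airyLaplace_ofReal (γ x : ℝ) :
    airyLaplace γ x =
      ((∫ t in Ioi (0 : ℝ), t ^ γ * Real.exp (-(t ^ 3 / 3) + x * t) : ℝ) : ℂ) := by
  rw [airyLaplace, ← integral_complex_ofReal]
  refine setIntegral_congr_fun measurableSet_Ioi fun t _ => ?_
  simp only [airyIntegrand]
  push_cast
  rfl

/-- The moment `∫_0^∞ t^γ exp (-t³/3) dt = F_γ(0)`, in closed form. -/
def airyMoment (γ : ℝ) : ℝ :=
  (3 : ℝ) ^ ((γ - 2) / 3) * Real.Gamma ((γ + 1) / 3)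

theorem airyLaplace_zero {γ : ℝ} (hγ : -1 < γ) : airyLaplace γ 0 = airyMoment γ := by
  have h_const : (1 / 3 : ℝ) ^ (-(γ + 1) / 3) * (1 / 3) = 3 ^ ((γ - 2) / 3) := by
    rw [one_div, Real.inv_rpow (by norm_num), ← Real.rpow_neg (by norm_num),
      ← Real.rpow_neg_one, ← Real.rpow_add (by norm_num)]
    congr 1
    ring
  rw [← Complex.ofReal_zero, airyLaplace_ofReal, airyMoment, ← h_const,
    ← integral_rpow_mul_exp_neg_mul_rpow (by norm_num) hγ (by norm_num)]
  norm_cast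
  refine setIntegral_congr_fun measurableSet_Ioi fun t _ => ?_
  simp only [zero_mul, add_zero]
  ring_nf

/-! ### Rotation of the path of integration -/

/-- The average of `g` over the segment `[0, z]` with weight `t ^ s`. It is `z ^ (-(s + 1))` times
the integral of `w ^ s * g w` along the segment, but has no branch point at `z = 0`. -/
def rayMean (s : ℝ) (g : ℂ → ℂ) (z : ℂ) : ℂ :=
  ∫ t in (0 : ℝ)..1, ((t ^ s : ℝ) : ℂ) * g (t * z)

theorem intervalIntegrable_rpow_mul {s : ℝ} (hs : -1 < s) {g : ℝ → ℂ} (hg : Continuous g)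
    (a b : ℝ) : IntervalIntegrable (fun r : ℝ => ((r ^ s : ℝ) : ℂ) * g r) volume a b :=
  IntervalIntegrable.mul_continuousOn
    ⟨(intervalIntegral.intervalIntegrable_rpow' hs).1.ofReal,
      (intervalIntegral.intervalIntegrable_rpow' hs).2.ofReal⟩ hg.continuousOn

section RayMean

variable {s : ℝ} {g : ℂ → ℂ}

theorem hasDerivAt_rayMean (hs : -1 < s) (hg : Differentiable ℂ g) (z : ℂ) :
    HasDerivAt (rayMean s g) (rayMean (s + 1) (deriv g) z) z := by
  have hg' : Continuous (deriv g) := (hg.contDiff (n := 1)).continuous_deriv le_rfl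
  obtain ⟨C, hC⟩ := (isCompact_closedBall (0 : ℂ) (‖z‖ + 1)).exists_bound_of_continuousOn
    hg'.continuousOn
  refine (intervalIntegral.hasDerivAt_integral_of_dominated_loc_of_deriv_le
    (bound := fun t => t ^ (s + 1) * C) (F' := fun w t => ((t ^ (s + 1) : ℝ) : ℂ) * deriv g (t * w))
    (Metric.ball_mem_nhds z one_pos)
    (Eventually.of_forall fun w => (intervalIntegrable_rpow_mul hs
      (hg.continuous.comp (by fun_prop)) 0 1).def'.aestronglyMeasurable)
    (intervalIntegrable_rpow_mul hs (hg.continuous.comp (by fun_prop)) 0 1)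
    (intervalIntegrable_rpow_mul (by linarith)
      (hg'.comp (by fun_prop)) 0 1).def'.aestronglyMeasurable ?_
    ((intervalIntegral.intervalIntegrable_rpow' (by linarith)).mul_const C) ?_).2
  · refine Eventually.of_forall fun t ht w hw => ?_
    rw [uIoc_of_le zero_le_one] at ht
    rw [norm_mul, Complex.norm_real, Real.norm_of_nonneg (Real.rpow_nonneg ht.1.le _)]
    refine mul_le_mul_of_nonneg_left (hC _ (mem_closedBall_zero_iff.2 ?_))
      (Real.rpow_nonneg ht.1.le _)
    have h_w : ‖w‖ ≤ ‖z‖ + 1 := by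
      linarith [mem_ball_iff_norm.1 hw, norm_le_insert' w z]
    rw [norm_mul, Complex.norm_real, Real.norm_of_nonneg ht.1.le]
    exact (mul_le_of_le_one_left (norm_nonneg w) ht.2).trans h_w
  · refine Eventually.of_forall fun t ht w _ => ?_
    rw [uIoc_of_le zero_le_one] at ht
    refine (((hg (t * w)).hasDerivAt.comp w
      ((hasDerivAt_id w).const_mul (t : ℂ))).const_mul ((t ^ s : ℝ) : ℂ)).congr_deriv ?_
    rw [Real.rpow_add_one ht.1.ne']
    push_cast
    ring

theorem add_one_mul_rayMean_add (hs : -1 < s) (hg : Differentiable ℂ g) (z : ℂ) :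
    (s + 1) * rayMean s g z + z * rayMean (s + 1) (deriv g) z = g z := by
  have hg' : Continuous (deriv g) := (hg.contDiff (n := 1)).continuous_deriv le_rfl
  have h_int₀ := (intervalIntegrable_rpow_mul hs (g := fun t => g (t * z))
    (hg.continuous.comp (by fun_prop)) 0 1).const_mul ((s : ℂ) + 1)
  have h_int₁ := (intervalIntegrable_rpow_mul (s := s + 1) (by linarith)
    (g := fun t => deriv g (t * z)) (hg'.comp (by fun_prop)) 0 1).const_mul z
  have h_cont : Continuous fun t : ℝ => ((t ^ (s + 1) : ℝ) : ℂ) * g (t * z) :=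
    (Complex.continuous_ofReal.comp (Real.continuous_rpow_const (by linarith))).mul
      (hg.continuous.comp (by fun_prop))
  have h_ftc := intervalIntegral.integral_eq_sub_of_hasDerivAt_of_le zero_le_one
    h_cont.continuousOn (fun t ht => ?_) (h_int₀.add h_int₁)
  · rw [intervalIntegral.integral_add h_int₀ h_int₁, intervalIntegral.integral_const_mul,
      intervalIntegral.integral_const_mul] at h_ftc
    simpa [rayMean, Real.zero_rpow (show s + 1 ≠ 0 by linarith)] using h_ftc
  · have h_comp : HasDerivAt (fun t : ℝ => g (t * z)) (deriv g (t * z) * (1 * z)) t :=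
      (hg (t * z)).hasDerivAt.comp t ((hasDerivAt_id t).ofReal_comp.mul_const z)
    refine ((hasDerivAt_ofReal_rpow_add_one s ht.1).fun_mul h_comp).congr_deriv ?_
    push_cast
    ring

theorem integral_rpow_mul_ray (s : ℝ) (g : ℂ → ℂ) {R : ℝ} (hR : 0 < R) (w : ℂ) :
    ∫ r in (0 : ℝ)..R, ((r ^ s : ℝ) : ℂ) * g (r * w) =
      ((R ^ (s + 1) : ℝ) : ℂ) * rayMean s g (R * w) := by
  have h_subst := intervalIntegral.smul_integral_comp_mul_left (a := 0) (b := 1)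
    (fun r : ℝ => ((r ^ s : ℝ) : ℂ) * g (r * w)) R
  rw [mul_zero, mul_one] at h_subst
  rw [← h_subst, rayMean, Real.rpow_add_one hR.ne', mul_comm (R ^ s), Complex.ofReal_mul,
    mul_assoc, ← intervalIntegral.integral_const_mul, Complex.real_smul]
  congr 1
  refine intervalIntegral.integral_congr fun t ht => ?_
  rw [uIcc_of_le zero_le_one] at ht
  simp only [Real.mul_rpow hR.le ht.1]
  push_cast
  ring_nf

theorem integral_ray_sub_integral_ray (hs : -1 < s) (hg : Differentiable ℂ g) {R : ℝ}
    (hR : 0 < R) (α : ℝ) :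
    Complex.exp ((s + 1) * α * Complex.I) *
        (∫ r in (0 : ℝ)..R, ((r ^ s : ℝ) : ℂ) * g (r * Complex.exp (α * Complex.I))) -
      ∫ r in (0 : ℝ)..R, ((r ^ s : ℝ) : ℂ) * g r =
    ((R ^ (s + 1) : ℝ) : ℂ) * ∫ θ in (0 : ℝ)..α,
      Complex.I * (Complex.exp ((s + 1) * θ * Complex.I) * g (circleMap 0 R θ)) := by
  have h_deriv (θ : ℝ) : HasDerivAt
      (fun θ : ℝ => Complex.exp ((s + 1) * θ * Complex.I) * rayMean s g (circleMap 0 R θ))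
      (Complex.I * (Complex.exp ((s + 1) * θ * Complex.I) * g (circleMap 0 R θ))) θ := by
    have h_lin : HasDerivAt (fun θ : ℝ => ((s : ℂ) + 1) * θ * Complex.I)
        ((s + 1) * Complex.I) θ := by
      simpa using ((hasDerivAt_id θ).ofReal_comp.const_mul ((s : ℂ) + 1)).mul_const Complex.I
    refine (h_lin.cexp.fun_mul ((hasDerivAt_rayMean hs hg _).comp θ
      (hasDerivAt_circleMap 0 R θ))).congr_deriv ?_
    rw [← add_one_mul_rayMean_add hs hg (circleMap 0 R θ), Function.comp_apply]
    ring
  have h_cont : Continuous fun θ : ℝ =>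
      Complex.I * (Complex.exp ((s + 1) * θ * Complex.I) * g (circleMap 0 R θ)) := by
    have := hg.continuous
    fun_prop
  rw [intervalIntegral.integral_eq_sub_of_hasDerivAt (fun θ _ => h_deriv θ)
    (h_cont.intervalIntegrable _ _), integral_rpow_mul_ray s g hR]
  have h_real := integral_rpow_mul_ray s g hR 1
  simp only [mul_one] at h_real
  rw [h_real]
  simp only [circleMap_zero, Complex.ofReal_zero, mul_zero, zero_mul, Complex.exp_zero, mul_one,
    one_mul]
  ring

end RayMean

/-- The entire function `z ↦ exp (i (z³/3 + x z))`. On the real axis it is the oscillating factor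
of the integrands of `Ai_γ` and `Gi_γ`, whose contour is rotated to the ray `arg z = π/6`. -/
def airyWave (x : ℝ) (z : ℂ) : ℂ := Complex.exp (Complex.I * (z ^ 3 / 3 + x * z))

theorem norm_airyWave_circleMap (x R θ : ℝ) :
    ‖airyWave x (circleMap 0 R θ)‖ =
      Real.exp (-(R ^ 3 / 3 * Real.sin (3 * θ) + x * R * Real.sin θ)) := by
  have h_polar : circleMap 0 R θ ^ 3 / 3 + x * circleMap 0 R θ =
      (R ^ 3 / 3 : ℝ) * Complex.exp ((3 * θ : ℝ) * Complex.I) +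
        (x * R : ℝ) * Complex.exp (θ * Complex.I) := by
    rw [circleMap_zero, mul_pow, ← Complex.exp_nat_mul]
    push_cast
    ring_nf
  rw [airyWave, h_polar, Complex.norm_exp, Complex.I_mul_re, Complex.add_im,
    Complex.im_ofReal_mul, Complex.im_ofReal_mul, Complex.exp_ofReal_mul_I_im,
    Complex.exp_ofReal_mul_I_im]

theorem norm_airyWave_circleMap_le {x R θ : ℝ} (hR : 2 * |x| + 2 ≤ R) (hθ : 0 ≤ θ)
    (hθ' : θ ≤ π / 6) : ‖airyWave x (circleMap 0 R θ)‖ ≤ Real.exp (-R ^ 2 * θ) := by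
  have hx := abs_nonneg x
  have hR₀ : 0 ≤ R := by linarith
  have h_pi := Real.pi_pos
  have h_sin_three : 3 / 2 * θ ≤ Real.sin (3 * θ) := by
    refine le_trans ?_ (Real.mul_le_sin (x := 3 * θ) (by linarith) (by linarith))
    have : 1 / 2 ≤ 2 / π := by
      rw [div_le_div_iff₀ (by norm_num) h_pi]; linarith [Real.pi_le_four]
    nlinarith
  have h_sin : -(|x| * θ) ≤ x * Real.sin θ := by
    have h_abs : |Real.sin θ| ≤ θ := by
      simpa [abs_of_nonneg hθ] using Real.abs_sin_le_abs (x := θ)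
    have := mul_le_mul_of_nonneg_left h_abs hx
    rw [← abs_mul] at this
    linarith [neg_abs_le (x * Real.sin θ)]
  have h_cubic := mul_le_mul_of_nonneg_left h_sin_three (show 0 ≤ R ^ 3 / 3 by positivity)
  have h_linear := mul_le_mul_of_nonneg_left h_sin hR₀
  have h_large : 0 ≤ R * θ * (R * (R - 2 * |x| - 2) + 2 * |x| * (R - 1)) :=
    mul_nonneg (mul_nonneg hR₀ hθ) (add_nonneg (mul_nonneg hR₀ (by linarith))
      (mul_nonneg (by linarith) (by linarith)))
  rw [norm_airyWave_circleMap]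
  exact Real.exp_le_exp.2 (by linarith)

theorem integral_exp_neg_mul_le {c b : ℝ} (hc : 0 < c) :
    ∫ θ in (0 : ℝ)..b, Real.exp (-c * θ) ≤ c⁻¹ := by
  rw [intervalIntegral.integral_comp_mul_left (fun t => Real.exp t) (neg_ne_zero.2 hc.ne'),
    integral_exp, mul_zero, Real.exp_zero, smul_eq_mul, inv_neg, neg_mul, ← mul_neg, neg_sub]
  exact mul_le_of_le_one_right (inv_nonneg.2 hc.le) (by linarith [Real.exp_pos (-c * b)])

theorem norm_integral_arc_airyWave_le (s : ℝ) {x R : ℝ} (hR : 2 * |x| + 2 ≤ R) :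
    ‖((R ^ (s + 1) : ℝ) : ℂ) * ∫ θ in (0 : ℝ)..(π / 6), Complex.I *
      (Complex.exp ((s + 1) * θ * Complex.I) * airyWave x (circleMap 0 R θ))‖ ≤ R ^ (s - 1) := by
  have hR₀ : 0 < R := by linarith [abs_nonneg x]
  have h_exp : Continuous fun θ : ℝ => Real.exp (-R ^ 2 * θ) := by fun_prop
  have h_arc : ‖∫ θ in (0 : ℝ)..(π / 6), Complex.I *
      (Complex.exp ((s + 1) * θ * Complex.I) * airyWave x (circleMap 0 R θ))‖ ≤ (R ^ 2)⁻¹ := by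
    refine (intervalIntegral.norm_integral_le_of_norm_le (by positivity)
      (Eventually.of_forall fun θ hθ => ?_) (h_exp.intervalIntegrable _ _)).trans
      (integral_exp_neg_mul_le (by positivity))
    have h_unit : ‖Complex.exp (((s : ℂ) + 1) * θ * Complex.I)‖ = 1 := by
      exact_mod_cast Complex.norm_exp_ofReal_mul_I ((s + 1) * θ)
    rw [norm_mul, norm_mul, h_unit, Complex.norm_I, one_mul, one_mul]
    exact norm_airyWave_circleMap_le hR hθ.1.le hθ.2
  have h_pow : R ^ (s + 1) * (R ^ 2)⁻¹ = R ^ (s - 1) := by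
    rw [← Real.rpow_natCast, ← Real.rpow_neg hR₀.le, ← Real.rpow_add hR₀]
    norm_num
    ring_nf
  rw [norm_mul, Complex.norm_real, Real.norm_of_nonneg (Real.rpow_nonneg hR₀.le _), ← h_pow]
  exact mul_le_mul_of_nonneg_left h_arc (Real.rpow_nonneg hR₀.le _)

/-- The primitive cube root of unity `e^{2πi/3}`. -/
def cubeRootUnity : ℂ := Complex.exp ((2 * π / 3 : ℝ) * Complex.I)

theorem airyWave_ray (x r : ℝ) :
    airyWave x (r * Complex.exp ((π / 6 : ℝ) * Complex.I)) =
      Complex.exp (-((r ^ 3 / 3 : ℝ) : ℂ) + cubeRootUnity * x * r) := by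
  have h_cube : Complex.exp ((π / 6 : ℝ) * Complex.I) ^ 3 = Complex.I := by
    nth_rewrite 2 [← Complex.exp_pi_div_two_mul_I]
    rw [← Complex.exp_nat_mul]
    congr 1
    push_cast
    ring
  have h_root : cubeRootUnity = Complex.I * Complex.exp ((π / 6 : ℝ) * Complex.I) := by
    rw [cubeRootUnity]
    nth_rewrite 2 [← Complex.exp_pi_div_two_mul_I]
    rw [← Complex.exp_add]
    congr 1
    push_cast
    ring
  rw [airyWave, mul_pow, h_cube, h_root]
  congr 1
  push_cast
  linear_combination ((r : ℂ) ^ 3 / 3) * Complex.I_sq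

theorem tendsto_integral_airyWave {γ : ℝ} (hγ : -1 < γ) (hγ' : γ < 1) (x : ℝ) :
    Tendsto (fun R : ℝ => ∫ r in (0 : ℝ)..R, ((r ^ γ : ℝ) : ℂ) * airyWave x r) atTop
      (𝓝 (Complex.exp ((γ + 1) * (π / 6 : ℝ) * Complex.I) *
        airyLaplace γ (cubeRootUnity * x))) := by
  have h_ray : Tendsto (fun R : ℝ => Complex.exp ((γ + 1) * (π / 6 : ℝ) * Complex.I) *
      ∫ r in (0 : ℝ)..R, ((r ^ γ : ℝ) : ℂ) *
        airyWave x (r * Complex.exp ((π / 6 : ℝ) * Complex.I))) atTop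
      (𝓝 (Complex.exp ((γ + 1) * (π / 6 : ℝ) * Complex.I) *
        airyLaplace γ (cubeRootUnity * x))) := by
    simp only [airyWave_ray]
    exact (intervalIntegral_tendsto_integral_Ioi 0
      (integrableOn_airyIntegrand hγ (cubeRootUnity * x)) tendsto_id).const_mul _
  have h_diff : Differentiable ℂ (airyWave x) := by
    unfold airyWave
    fun_prop
  have h_arc : Tendsto (fun R : ℝ => Complex.exp ((γ + 1) * (π / 6 : ℝ) * Complex.I) *
      (∫ r in (0 : ℝ)..R, ((r ^ γ : ℝ) : ℂ) *
        airyWave x (r * Complex.exp ((π / 6 : ℝ) * Complex.I))) -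
      ∫ r in (0 : ℝ)..R, ((r ^ γ : ℝ) : ℂ) * airyWave x r) atTop (𝓝 0) := by
    refine squeeze_zero_norm' (a := fun R => R ^ (γ - 1)) ?_ ?_
    · filter_upwards [eventually_ge_atTop (2 * |x| + 2)] with R hR
      rw [integral_ray_sub_integral_ray hγ h_diff (by linarith [abs_nonneg x])]
      exact norm_integral_arc_airyWave_le γ hR
    · simpa using tendsto_rpow_neg_atTop (y := 1 - γ) (by linarith)
  simpa using h_ray.sub h_arc

/-- The constant with `Ai_γ(x) + i Gi_γ(x) = airyCoeff γ * F_γ(e^{2πi/3} x)`. -/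
def airyCoeff (γ : ℝ) : ℂ :=
  (1 / π : ℝ) * Complex.exp ((π / 6 - γ * π / 3 : ℝ) * Complex.I)

theorem tendsto_integral_rpow_mul_exp {γ : ℝ} (hγ : -1 < γ) (hγ' : γ < 1) (x : ℝ) :
    Tendsto (fun R : ℝ => ∫ σ in (0 : ℝ)..R, ((σ ^ γ : ℝ) : ℂ) *
      Complex.exp ((σ ^ 3 / 3 + x * σ - γ * π / 2 : ℝ) * Complex.I)) atTop
      (𝓝 (π * (airyCoeff γ * airyLaplace γ (cubeRootUnity * x)))) := by
  have h_phase : (π : ℂ) * (airyCoeff γ * airyLaplace γ (cubeRootUnity * x)) =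
      Complex.exp ((-(γ * π / 2) : ℝ) * Complex.I) *
        (Complex.exp ((γ + 1) * (π / 6 : ℝ) * Complex.I) *
          airyLaplace γ (cubeRootUnity * x)) := by
    rw [airyCoeff, ← mul_assoc, ← mul_assoc, ← mul_assoc, ← Complex.ofReal_mul,
      mul_one_div_cancel Real.pi_ne_zero, Complex.ofReal_one, one_mul, ← Complex.exp_add]
    push_cast
    ring_nf
  rw [h_phase]
  refine ((tendsto_integral_airyWave hγ hγ' x).const_mul _).congr fun R => ?_
  rw [← intervalIntegral.integral_const_mul]
  refine intervalIntegral.integral_congr fun σ _ => ?_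
  simp only [airyWave]
  rw [mul_left_comm, ← Complex.exp_add]
  push_cast
  ring_nf

theorem limUnder_integral_comp_clm {γ : ℝ} (hγ : -1 < γ) (hγ' : γ < 1) (x : ℝ) (L : ℂ →L[ℝ] ℝ) :
    1 / π * limUnder atTop (fun R : ℝ => ∫ σ in (0 : ℝ)..R,
      σ ^ γ * L (Complex.exp ((σ ^ 3 / 3 + x * σ - γ * π / 2 : ℝ) * Complex.I))) =
      L (airyCoeff γ * airyLaplace γ (cubeRootUnity * x)) := by
  have h_smul (r : ℝ) (z : ℂ) : L (r * z) = r * L z := by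
    rw [← Complex.real_smul, map_smul, smul_eq_mul]
  have h_lim : Tendsto (fun R : ℝ => ∫ σ in (0 : ℝ)..R,
      σ ^ γ * L (Complex.exp ((σ ^ 3 / 3 + x * σ - γ * π / 2 : ℝ) * Complex.I))) atTop
      (𝓝 (L (π * (airyCoeff γ * airyLaplace γ (cubeRootUnity * x))))) := by
    refine ((L.continuous.tendsto _).comp (tendsto_integral_rpow_mul_exp hγ hγ' x)).congr
      fun R => ?_
    rw [Function.comp_apply, ← L.intervalIntegral_comp_comm
      (intervalIntegrable_rpow_mul hγ (by fun_prop) 0 R)]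
    simp only [h_smul]
  rw [h_lim.limUnder_eq, h_smul, ← mul_assoc, one_div_mul_cancel Real.pi_ne_zero, one_mul]

theorem genAi_eq {γ : ℝ} (hγ : -1 < γ) (hγ' : γ < 1) (x : ℝ) :
    genAi γ x = (airyCoeff γ * airyLaplace γ (cubeRootUnity * x)).re := by
  simpa only [genAi, Complex.reCLM_apply, Complex.exp_ofReal_mul_I_re] using
    limUnder_integral_comp_clm hγ hγ' x Complex.reCLM

theorem genGi_eq {γ : ℝ} (hγ : -1 < γ) (hγ' : γ < 1) (x : ℝ) :
    genGi γ x = (airyCoeff γ * airyLaplace γ (cubeRootUnity * x)).im := by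
  simpa only [genGi, Complex.imCLM_apply, Complex.exp_ofReal_mul_I_im] using
    limUnder_integral_comp_clm hγ hγ' x Complex.imCLM

theorem genHi_eq (γ x : ℝ) :
    genHi γ x = (((1 / π : ℝ) : ℂ) * airyLaplace γ (1 * x)).re := by
  rw [one_mul, airyLaplace_ofReal, ← Complex.ofReal_mul, Complex.ofReal_re, genHi]

/-! ### The three solutions of the homogeneous equation -/

/-- The coefficients `c_i` in `Ai_γ`, `Gi_γ`, `Hi_γ` (in this order) `= Re (c_i F_γ(d_i x))`. -/
def solCoeff (γ : ℝ) : Fin 3 → ℂ :=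
  ![airyCoeff γ, -Complex.I * airyCoeff γ, ((1 / π : ℝ) : ℂ)]

/-- The cube roots of unity `d_i` in `Ai_γ`, `Gi_γ`, `Hi_γ` (in this order)
`= Re (c_i F_γ(d_i x))`. -/
def solDir : Fin 3 → ℂ := ![cubeRootUnity, cubeRootUnity, 1]

/-- The `k`-th derivatives of `Ai_γ`, `Gi_γ`, `Hi_γ`, indexed by `i` in this order. -/
def solJet (γ : ℝ) (i : Fin 3) (k : ℕ) (x : ℝ) : ℝ :=
  (solCoeff γ i * solDir i ^ k * airyLaplace (γ + k) (solDir i * x)).re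

theorem cubeRootUnity_pow_three : cubeRootUnity ^ 3 = 1 := by
  rw [cubeRootUnity, ← Complex.exp_nat_mul, ← Complex.exp_two_pi_mul_I]
  congr 1
  push_cast
  ring

theorem cubeRootUnity_re : cubeRootUnity.re = -(1 / 2) := by
  rw [cubeRootUnity, Complex.exp_ofReal_mul_I_re,
    show 2 * π / 3 = π - π / 3 by ring, Real.cos_pi_sub, Real.cos_pi_div_three]

theorem solDir_pow_three (i : Fin 3) : solDir i ^ 3 = 1 := by
  fin_cases i <;> simp [solDir, cubeRootUnity_pow_three]

theorem solJet_zero_eq_genAi {γ : ℝ} (hγ : -1 < γ) (hγ' : γ < 1) (x : ℝ) :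
    solJet γ 0 0 x = genAi γ x := by
  simp [solJet, solCoeff, solDir, genAi_eq hγ hγ']

theorem solJet_one_eq_genGi {γ : ℝ} (hγ : -1 < γ) (hγ' : γ < 1) (x : ℝ) :
    solJet γ 1 0 x = genGi γ x := by
  simp [solJet, solCoeff, solDir, genGi_eq hγ hγ']

theorem solJet_two_eq_genHi (γ x : ℝ) : solJet γ 2 0 x = genHi γ x := by
  simp [solJet, solCoeff, solDir, genHi_eq]

section SolJet

variable {γ : ℝ} (hγ : -1 < γ)

include hγ

theorem neg_one_lt_add_natCast (k : ℕ) : -1 < γ + k := by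
  linarith [k.cast_nonneg (α := ℝ)]

theorem hasDerivAt_solJet (i : Fin 3) (k : ℕ) (x : ℝ) :
    HasDerivAt (solJet γ i k) (solJet γ i (k + 1) x) x := by
  have h_dir : HasDerivAt (fun x : ℝ => solDir i * (x : ℂ)) (solDir i) x := by
    simpa using (hasDerivAt_id x).ofReal_comp.const_mul (solDir i)
  have h_complex := ((hasDerivAt_airyLaplace (neg_one_lt_add_natCast hγ k)
    (solDir i * x)).comp x h_dir).const_mul (solCoeff γ i * solDir i ^ k)
  refine (Complex.reCLM.hasFDerivAt.comp_hasDerivAt x h_complex).congr_deriv ?_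
  rw [Complex.reCLM_apply, solJet, Nat.cast_add_one, add_assoc γ]
  ring_nf

theorem continuous_solJet (i : Fin 3) (k : ℕ) : Continuous (solJet γ i k) :=
  continuous_iff_continuousAt.2 fun x => (hasDerivAt_solJet hγ i k x).continuousAt

theorem solJet_three (i : Fin 3) (x : ℝ) :
    solJet γ i 3 x = x * solJet γ i 1 x + (γ + 1) * solJet γ i 0 x := by
  have h_complex : solCoeff γ i * solDir i ^ 3 * airyLaplace (γ + 3) (solDir i * x) =
      x * (solCoeff γ i * solDir i ^ 1 * airyLaplace (γ + 1) (solDir i * x)) +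
        ((γ + 1 : ℝ) : ℂ) * (solCoeff γ i * solDir i ^ 0 * airyLaplace γ (solDir i * x)) := by
    rw [airyLaplace_add_three hγ, solDir_pow_three]
    push_cast
    ring
  have h_re := congrArg Complex.re h_complex
  rw [Complex.add_re, Complex.re_ofReal_mul, Complex.re_ofReal_mul] at h_re
  simpa only [solJet, Nat.cast_ofNat, Nat.cast_one, Nat.cast_zero, add_zero] using h_re

theorem solJet_isBigO {i : Fin 3} {l : Filter ℝ} {c : ℝ} (hc : 0 < c)
    (h_re : ∀ᶠ x : ℝ in l, (solDir i * x).re ≤ -(c * |x|)) (hl : ∀ᶠ x : ℝ in l, x ≠ 0) (k : ℕ) :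
    solJet γ i k =O[l] fun x => |x| ^ (-(1 + (γ + k))) := by
  refine .of_bound (‖solCoeff γ i * solDir i ^ k‖ *
    (Real.Gamma (γ + k + 1) * c ^ (-(1 + (γ + k))))) ?_
  filter_upwards [h_re, hl] with x hx hx0
  have h_le := norm_airyLaplace_le (neg_one_lt_add_natCast hγ k)
    (mul_pos hc (abs_pos.2 hx0)) hx
  rw [Real.mul_rpow hc.le (abs_nonneg x), ← mul_assoc] at h_le
  rw [solJet, Real.norm_eq_abs, Real.norm_of_nonneg (by positivity), mul_assoc ‖_‖]
  exact (Complex.abs_re_le_norm _).trans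
    ((norm_mul _ _).trans_le (mul_le_mul_of_nonneg_left h_le (norm_nonneg _)))

theorem solJet_isBigO_atTop {i : Fin 3} (hi : i ≠ 2) (k : ℕ) :
    solJet γ i k =O[atTop] fun x => |x| ^ (-(1 + (γ + k))) := by
  have h_dir : solDir i = cubeRootUnity := by
    fin_cases i <;> simp_all [solDir]
  refine solJet_isBigO hγ one_half_pos ?_ (eventually_ne_atTop 0) k
  filter_upwards [eventually_ge_atTop 0] with x hx
  rw [h_dir, Complex.re_mul_ofReal, cubeRootUnity_re, abs_of_nonneg hx, neg_mul]

theorem solJet_isBigO_atBot (k : ℕ) :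
    solJet γ 2 k =O[atBot] fun x => |x| ^ (-(1 + (γ + k))) := by
  refine solJet_isBigO hγ one_pos ?_ (eventually_ne_atBot 0) k
  filter_upwards [eventually_le_atBot 0] with x hx
  simp [solDir, abs_of_nonpos hx]

end SolJet

/-! ### The Wronskian relation between the indices `γ` and `-1 - γ` -/

/-- The argument of the complex number `Ai_γ^{(k)}(0) + i Gi_γ^{(k)}(0)`. -/
def airyArg (γ : ℝ) (k : ℕ) : ℝ := π / 6 - γ * π / 3 + k * (2 * π / 3)

theorem airyCoeff_mul_pow (γ : ℝ) (k : ℕ) : airyCoeff γ * cubeRootUnity ^ k =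
    ((1 / π : ℝ) : ℂ) * Complex.exp ((airyArg γ k : ℝ) * Complex.I) := by
  rw [airyCoeff, cubeRootUnity, ← Complex.exp_nat_mul, mul_assoc, ← Complex.exp_add, airyArg]
  congr 2
  push_cast
  ring

theorem solJet_at_zero {γ : ℝ} (hγ : -1 < γ) (i : Fin 3) (k : ℕ) :
    solJet γ i k 0 = airyMoment (γ + k) / π *
      ![Real.cos (airyArg γ k), Real.sin (airyArg γ k), 1] i := by
  rw [solJet, Complex.ofReal_zero, mul_zero, airyLaplace_zero (neg_one_lt_add_natCast hγ k),
    Complex.re_mul_ofReal]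
  fin_cases i
  · simp only [solCoeff, solDir, Fin.zero_eta, Matrix.cons_val_zero, airyCoeff_mul_pow,
      Complex.re_ofReal_mul, Complex.exp_ofReal_mul_I_re]
    ring
  · simp only [solCoeff, solDir, Fin.mk_one, Matrix.cons_val_one, mul_assoc, airyCoeff_mul_pow,
      Matrix.cons_val_zero]
    rw [neg_mul, Complex.neg_re, Complex.I_mul_re, Complex.im_ofReal_mul,
      Complex.exp_ofReal_mul_I_im]
    ring
  · simp only [solCoeff, solDir, Fin.reduceFinMk, Matrix.cons_val, one_pow, mul_one,
      Complex.ofReal_re]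
    ring

/-- The numbers `sin ((γ + n) π / 3)`, which carry all trigonometric values occurring in the
Wronskians at the origin. -/
def sineSeq (γ : ℝ) (n : ℤ) : ℝ := Real.sin (γ * π / 3 + n * (π / 3))

theorem sineSeq_add_two (γ : ℝ) (n : ℤ) :
    sineSeq γ (n + 2) = sineSeq γ (n + 1) - sineSeq γ n := by
  have h_prev : γ * π / 3 + n * (π / 3) = γ * π / 3 + (n + 1) * (π / 3) - π / 3 := by ring
  have h_next : γ * π / 3 + (n + 2) * (π / 3) = γ * π / 3 + (n + 1) * (π / 3) + π / 3 := by ring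
  simp only [sineSeq, Int.cast_add, Int.cast_one, Int.cast_ofNat]
  rw [h_prev, h_next, Real.sin_add, Real.sin_sub, Real.cos_pi_div_three]
  ring

theorem sineSeq_pos {γ : ℝ} {n : ℤ} (h : 0 < γ + n) (h' : γ + n < 3) : 0 < sineSeq γ n := by
  have h_pi : 0 < π / 3 := by positivity
  apply Real.sin_pos_of_pos_of_lt_pi <;> nlinarith

theorem cos_airyArg (γ : ℝ) (k : ℕ) : Real.cos (airyArg γ k) = sineSeq γ (1 - 2 * k) := by
  rw [← Real.sin_pi_div_two_sub, airyArg, sineSeq]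
  congr 1
  push_cast
  ring

theorem cos_airyArg_neg_one_sub (γ : ℝ) (l : ℕ) :
    Real.cos (airyArg (-1 - γ) l) = -sineSeq γ (2 * l) := by
  rw [sineSeq, ← Real.cos_add_pi_div_two, airyArg]
  congr 1
  push_cast
  ring

theorem sin_airyArg_sub (γ : ℝ) (k l : ℕ) :
    Real.sin (γ * π + airyArg γ k - airyArg (-1 - γ) l) = sineSeq γ (2 * k - 2 * l - 1) := by
  rw [airyArg, airyArg, sineSeq]
  congr 1
  push_cast
  ring

theorem sineSeq_sum (γ : ℝ) (k l : Fin 3) :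
    sineSeq γ (1 - 2 * (k : ℕ)) - sineSeq γ (2 * (l : ℕ)) +
        sineSeq γ (2 * (k : ℕ) - 2 * (l : ℕ) - 1) =
      if (k : ℕ) + l = 2 then (-1) ^ (k : ℕ) * (3 * sineSeq γ ((k : ℕ) + 1)) else 0 := by
  have h_three (n m : ℤ) (h : n + 3 = m) : sineSeq γ m = -sineSeq γ n := by
    rw [← h, show n + 3 = n + 1 + 2 by ring, sineSeq_add_two, add_assoc, one_add_one_eq_two,
      sineSeq_add_two]
    ring
  have h_two : sineSeq γ 2 = sineSeq γ 1 - sineSeq γ 0 := sineSeq_add_two γ 0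
  fin_cases k <;> fin_cases l <;> norm_num <;>
    linarith [h_three (-5) (-2) rfl, h_three (-3) 0 rfl, h_three (-2) 1 rfl, h_three (-1) 2 rfl,
      h_three 0 3 rfl, h_three 1 4 rfl]

theorem airyMoment_mul {γ : ℝ} {k l : ℕ} (h : k + l = 2) :
    airyMoment (γ + k) * airyMoment (-1 - γ + l) = π / (3 * sineSeq γ (k + 1)) := by
  have hl : (l : ℝ) = 2 - k := by
    rw [eq_sub_iff_add_eq']
    exact_mod_cast h
  have h_arg : (-1 - γ + (2 - k) + 1) / 3 = 1 - (γ + k + 1) / 3 := by ring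
  have h_three : (3 : ℝ) ^ ((γ + k - 2) / 3) * 3 ^ ((-1 - γ + (2 - k) - 2) / 3) = 1 / 3 := by
    rw [← Real.rpow_add (by norm_num),
      show (γ + k - 2) / 3 + (-1 - γ + (2 - k) - 2) / 3 = -1 by ring, Real.rpow_neg_one]
    norm_num
  rw [airyMoment, airyMoment, hl, h_arg, mul_mul_mul_comm, h_three,
    Real.Gamma_mul_Gamma_one_sub, sineSeq,
    show π * ((γ + k + 1) / 3) = γ * π / 3 + ((k + 1 : ℤ) : ℝ) * (π / 3) by push_cast; ring]
  ring

/-- The matrix `M` such that, with `u` and `v` the triples `Ai`, `Gi`, `Hi` of index `γ` and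
`-1 - γ`, the kernel is `∑ M i j u_i(x) v_j(y)` over `i = 2` for `x < y`, and minus this sum over
`i = 0, 1` for `y < x`. -/
def kernelMatrix (γ : ℝ) : Matrix (Fin 3) (Fin 3) ℝ :=
  π • !![Real.sin (γ * π), -Real.cos (γ * π), 1;
    Real.cos (γ * π), Real.sin (γ * π), 0; 1, 0, 0]

/-- The Wronskian matrix of the three solutions, with the order of differentiation as row index. -/
def wronskianMatrix (γ x : ℝ) : Matrix (Fin 3) (Fin 3) ℝ :=
  Matrix.of fun k i => solJet γ i k x

/-- The matrix of the bilinear concomitant `u'' v - u' v' + u v'' - x u v` of `L_γ`. -/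
def concomitantMatrix (x : ℝ) : Matrix (Fin 3) (Fin 3) ℝ :=
  !![-x, 0, 1; 0, -1, 0; 1, 0, 0]

section Wronskian

variable {γ : ℝ} (hγ : -1 < γ) (hγ' : γ < 0)

include hγ hγ'

open scoped Matrix

theorem concomitant_const (x : ℝ) :
    (wronskianMatrix γ x)ᵀ * concomitantMatrix x * wronskianMatrix (-1 - γ) x =
      (wronskianMatrix γ 0)ᵀ * concomitantMatrix 0 * wronskianMatrix (-1 - γ) 0 := by
  ext i j
  have hν : -1 < -1 - γ := by linarith
  let concomitant (x : ℝ) : ℝ := solJet γ i 2 x * solJet (-1 - γ) j 0 x -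
    solJet γ i 1 x * solJet (-1 - γ) j 1 x + solJet γ i 0 x * solJet (-1 - γ) j 2 x -
    x * (solJet γ i 0 x * solJet (-1 - γ) j 0 x)
  have h_entry (x : ℝ) : ((wronskianMatrix γ x)ᵀ * concomitantMatrix x *
      wronskianMatrix (-1 - γ) x) i j = concomitant x := by
    simp [Matrix.mul_apply, Fin.sum_univ_three, wronskianMatrix, concomitantMatrix, concomitant]
    ring
  have h_deriv (x : ℝ) : HasDerivAt concomitant 0 x := by
    have hu (k : ℕ) := hasDerivAt_solJet hγ i k x
    have hv (k : ℕ) := hasDerivAt_solJet hν j k x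
    refine (((((hu 2).fun_mul (hv 0)).fun_sub ((hu 1).fun_mul (hv 1))).fun_add
      ((hu 0).fun_mul (hv 2))).fun_sub
        ((hasDerivAt_id x).fun_mul ((hu 0).fun_mul (hv 0)))).congr_deriv ?_
    simp only [id_eq, Nat.reduceAdd, zero_add, solJet_three hγ, solJet_three hν]
    ring
  rw [h_entry, h_entry]
  exact is_const_of_deriv_eq_zero (fun x => (h_deriv x).differentiableAt)
    (fun x => (h_deriv x).deriv) x 0

theorem wronskian_mul_kernel_mul_entry (k l : Fin 3) :
    (wronskianMatrix γ 0 * kernelMatrix γ * (wronskianMatrix (-1 - γ) 0)ᵀ) k l =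
      airyMoment (γ + (k : ℕ)) * airyMoment (-1 - γ + (l : ℕ)) / π *
        (sineSeq γ (1 - 2 * (k : ℕ)) - sineSeq γ (2 * (l : ℕ)) +
          sineSeq γ (2 * (k : ℕ) - 2 * (l : ℕ) - 1)) := by
  rw [sub_eq_add_neg (sineSeq γ _), ← cos_airyArg, ← cos_airyArg_neg_one_sub, ← sin_airyArg_sub,
    add_sub_assoc, Real.sin_add, Real.cos_sub, Real.sin_sub]
  simp [Matrix.mul_apply, Fin.sum_univ_three, wronskianMatrix, kernelMatrix, solJet_at_zero hγ,
    solJet_at_zero (show -1 < -1 - γ by linarith)]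
  field_simp
  ring

theorem wronskian_mul_kernel_mul_at_zero :
    wronskianMatrix γ 0 * kernelMatrix γ * (wronskianMatrix (-1 - γ) 0)ᵀ =
      concomitantMatrix 0 := by
  ext k l
  have h_concomitant :
      concomitantMatrix 0 k l = if (k : ℕ) + l = 2 then (-1) ^ (k : ℕ) else 0 := by
    fin_cases k <;> fin_cases l <;> simp [concomitantMatrix]
  rw [wronskian_mul_kernel_mul_entry hγ hγ', sineSeq_sum, h_concomitant]
  split_ifs with h
  · have hk : (k : ℝ) ≤ 2 := by exact_mod_cast Nat.lt_succ_iff.1 k.isLt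
    have h_sine := (sineSeq_pos (γ := γ) (n := (k : ℕ) + 1)
      (by push_cast; linarith [(k : ℕ).cast_nonneg (α := ℝ)]) (by push_cast; linarith)).ne'
    rw [airyMoment_mul h]
    field_simp
  · rw [mul_zero]

theorem wronskian_mul_eq_one (x : ℝ) :
    wronskianMatrix γ x *
      (kernelMatrix γ * (wronskianMatrix (-1 - γ) x)ᵀ * concomitantMatrix x) = 1 := by
  have h_symm (x : ℝ) : (concomitantMatrix x)ᵀ = concomitantMatrix x := by
    ext k l
    fin_cases k <;> fin_cases l <;> rfl
  have h_transpose (x : ℝ) : kernelMatrix γ * (wronskianMatrix (-1 - γ) x)ᵀ *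
      concomitantMatrix x * wronskianMatrix γ x = kernelMatrix γ *
        ((wronskianMatrix γ x)ᵀ * concomitantMatrix x * wronskianMatrix (-1 - γ) x)ᵀ := by
    simp only [Matrix.transpose_mul, Matrix.transpose_transpose, h_symm, mul_assoc]
  rw [mul_eq_one_comm, h_transpose, concomitant_const hγ hγ', ← h_transpose, mul_eq_one_comm,
    ← mul_assoc, ← mul_assoc, wronskian_mul_kernel_mul_at_zero hγ hγ']
  ext i j
  fin_cases i <;> fin_cases j <;> simp [concomitantMatrix, Matrix.mul_apply, Fin.sum_univ_three]

theorem sum_solJet_mul_kernel (x : ℝ) (k : Fin 3) :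
    ∑ i, solJet γ i k x * ∑ j, kernelMatrix γ i j * solJet (-1 - γ) j 0 x =
      if k = 2 then 1 else 0 := by
  have h_entry := congrFun (congrFun (wronskian_mul_eq_one hγ hγ' x) k) 2
  rw [Matrix.one_apply] at h_entry
  rw [← h_entry]
  simp [Matrix.mul_apply, Fin.sum_univ_three, wronskianMatrix, concomitantMatrix]

end Wronskian

/-! ### Variation of constants -/

theorem hasDerivAt_integral_Iic {g : ℝ → ℝ} (hg : Continuous g) (hg' : Integrable g) (x : ℝ) :
    HasDerivAt (fun x => ∫ y in Iic x, g y) (g x) x := by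
  have h_split : (fun x => ∫ y in Iic x, g y) =
      fun x => (∫ y in (0 : ℝ)..x, g y) + ∫ y in Iic 0, g y := by
    funext x
    rw [← intervalIntegral.integral_Iic_sub_Iic hg'.integrableOn hg'.integrableOn,
      sub_add_cancel]
  rw [h_split]
  exact (hg.integral_hasStrictDerivAt 0 x).hasDerivAt.add_const _

theorem hasDerivAt_integral_Ioi {g : ℝ → ℝ} (hg : Continuous g) (hg' : Integrable g) (x : ℝ) :
    HasDerivAt (fun x => ∫ y in Ioi x, g y) (-g x) x := by
  have h_split : (fun x => ∫ y in Ioi x, g y) = fun x => (∫ y, g y) - ∫ y in Iic x, g y := by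
    funext x
    rw [← intervalIntegral.integral_Iic_add_Ioi hg'.integrableOn hg'.integrableOn,
      add_sub_cancel_left]
  rw [h_split]
  exact (hasDerivAt_integral_Iic hg hg' x).const_sub _

/-- The solutions of the adjoint equation paired with `Ai_γ`, `Gi_γ`, `Hi_γ` in the kernel. -/
def dualSol (γ : ℝ) (i : Fin 3) (y : ℝ) : ℝ :=
  ∑ j, kernelMatrix γ i j * solJet (-1 - γ) j 0 y

/-- The coefficients in the method of variation of constants. The limits of integration make the
weight of `Hi_γ` vanish near `+∞` and those of `Ai_γ`, `Gi_γ` vanish near `-∞`, where these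
solutions fail to decay. -/
def greenWeight (γ : ℝ) (f : C_c(ℝ, ℝ)) (i : Fin 3) (x : ℝ) : ℝ :=
  if i = 2 then ∫ y in Ioi x, dualSol γ i y * f y else -∫ y in Iic x, dualSol γ i y * f y

/-- The sums `∑ u_i^{(k)} w_i`, which for `k ≤ 2` are the derivatives of the solution `∑ u_i w_i`
obtained by variation of constants. -/
def greenJet (γ : ℝ) (f : C_c(ℝ, ℝ)) (k : ℕ) (x : ℝ) : ℝ :=
  ∑ i, solJet γ i k x * greenWeight γ f i x

section Green

variable {γ : ℝ} (hγ : -1 < γ) (hγ' : γ < 0) (f : C_c(ℝ, ℝ))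

theorem greenWeight_two_eventuallyEq_zero : ∀ᶠ x in atTop, greenWeight γ f 2 x = 0 := by
  obtain ⟨R, -, hR⟩ := f.hasCompactSupport.exists_pos_le_norm
  filter_upwards [eventually_ge_atTop R] with x hx
  rw [greenWeight, if_pos rfl]
  refine setIntegral_eq_zero_of_forall_eq_zero fun y (hy : x < y) => ?_
  rw [hR y (hx.trans (hy.le.trans (le_abs_self y))), mul_zero]

theorem greenWeight_eventuallyEq_zero {i : Fin 3} (hi : i ≠ 2) :
    ∀ᶠ x in atBot, greenWeight γ f i x = 0 := by
  obtain ⟨R, -, hR⟩ := f.hasCompactSupport.exists_pos_le_norm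
  filter_upwards [eventually_le_atBot (-R)] with x hx
  rw [greenWeight, if_neg hi, neg_eq_zero]
  refine setIntegral_eq_zero_of_forall_eq_zero fun y (hy : y ≤ x) => ?_
  rw [hR y ((le_neg.1 (hy.trans hx)).trans (neg_le_abs y)), mul_zero]

include hγ in
theorem greenJet_three (x : ℝ) :
    greenJet γ f 3 x = x * greenJet γ f 1 x + (γ + 1) * greenJet γ f 0 x := by
  simp only [greenJet, solJet_three hγ, Finset.mul_sum, ← Finset.sum_add_distrib]
  exact Finset.sum_congr rfl fun i _ => by ring

include hγ'

theorem continuous_dualSol_mul (i : Fin 3) : Continuous fun y => dualSol γ i y * f y :=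
  (continuous_finsetSum _ fun j _ =>
    (continuous_solJet (by linarith : -1 < -1 - γ) j 0).const_mul _).mul f.continuous

theorem integrable_dualSol_mul (i : Fin 3) : Integrable fun y => dualSol γ i y * f y :=
  (continuous_dualSol_mul hγ' f i).integrable_of_hasCompactSupport f.hasCompactSupport.mul_left

theorem hasDerivAt_greenWeight (i : Fin 3) (x : ℝ) :
    HasDerivAt (greenWeight γ f i) (-(dualSol γ i x * f x)) x := by
  have h_cont := continuous_dualSol_mul hγ' f i
  have h_int := integrable_dualSol_mul hγ' f i
  unfold greenWeight
  split_ifs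
  · exact hasDerivAt_integral_Ioi h_cont h_int x
  · exact (hasDerivAt_integral_Iic h_cont h_int x).fun_neg

theorem greenWeight_isBigO_one (i : Fin 3) (l : Filter ℝ) :
    greenWeight γ f i =O[l] fun _ => (1 : ℝ) := by
  refine .of_bound (∫ y, |dualSol γ i y * f y|) (.of_forall fun x => ?_)
  have h_set (s : Set ℝ) : |∫ y in s, dualSol γ i y * f y| ≤ ∫ y, |dualSol γ i y * f y| :=
    abs_integral_le_integral_abs.trans (setIntegral_le_integral
      (integrable_dualSol_mul hγ' f i).abs (.of_forall fun _ => abs_nonneg _))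
  rw [norm_one, mul_one, Real.norm_eq_abs]
  unfold greenWeight
  split_ifs
  · exact h_set _
  · exact (abs_neg _).trans_le (h_set _)

include hγ

theorem continuous_greenJet (k : ℕ) : Continuous (greenJet γ f k) :=
  continuous_finsetSum _ fun i _ => (continuous_solJet hγ i k).mul <|
    continuous_iff_continuousAt.2 fun x => (hasDerivAt_greenWeight hγ' f i x).continuousAt

theorem hasDerivAt_greenJet {k : ℕ} (hk : k < 3) (x : ℝ) :
    HasDerivAt (greenJet γ f k) (greenJet γ f (k + 1) x - if k = 2 then f x else 0) x := by
  have h_sum : HasDerivAt (greenJet γ f k) (∑ i, (solJet γ i (k + 1) x * greenWeight γ f i x +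
      solJet γ i k x * -(dualSol γ i x * f x))) x :=
    .fun_sum fun i _ => (hasDerivAt_solJet hγ i k x).fun_mul (hasDerivAt_greenWeight hγ' f i x)
  have h_wronskian : ∑ i, solJet γ i k x * dualSol γ i x = if k = 2 then 1 else 0 := by
    simpa [dualSol, Fin.ext_iff] using sum_solJet_mul_kernel hγ hγ' x ⟨k, hk⟩
  refine h_sum.congr_deriv ?_
  rw [← one_mul (f x), ← zero_mul (f x), ← ite_mul, ← h_wronskian, Finset.sum_mul, greenJet,
    ← Finset.sum_sub_distrib]
  exact Finset.sum_congr rfl fun i _ => by ring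

theorem iteratedDeriv_greenJet {k : ℕ} (hk : k < 3) :
    iteratedDeriv k (greenJet γ f 0) = greenJet γ f k := by
  induction k with
  | zero => exact iteratedDeriv_zero
  | succ k ih =>
    funext x
    rw [iteratedDeriv_succ, ih (by lia), (hasDerivAt_greenJet hγ hγ' f (by lia) x).deriv,
      if_neg (by lia), sub_zero]

theorem iteratedDeriv_three_greenJet :
    iteratedDeriv 3 (greenJet γ f 0) = fun x => greenJet γ f 3 x - f x := by
  funext x
  rw [iteratedDeriv_succ, iteratedDeriv_greenJet hγ hγ' f (by simp),
    (hasDerivAt_greenJet hγ hγ' f (by simp) x).deriv, if_pos rfl]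

theorem contDiff_greenJet : ContDiff ℝ 3 (greenJet γ f 0) := by
  refine contDiff_nat_iff_iteratedDeriv.2 ⟨fun k hk => ?_, fun k hk => ?_⟩
  · rcases hk.lt_or_eq with hk | rfl
    · rw [iteratedDeriv_greenJet hγ hγ' f hk]
      exact continuous_greenJet hγ hγ' f k
    · rw [iteratedDeriv_three_greenJet hγ hγ' f]
      exact (continuous_greenJet hγ hγ' f 3).sub f.continuous
  · rw [iteratedDeriv_greenJet hγ hγ' f hk]
    exact fun x => (hasDerivAt_greenJet hγ hγ' f hk x).differentiableAt

theorem opL_greenJet : opL γ (greenJet γ f 0) = f := by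
  funext x
  rw [opL, ← iteratedDeriv_one, iteratedDeriv_greenJet hγ hγ' f (by simp),
    iteratedDeriv_three_greenJet hγ hγ' f]
  simp only [greenJet_three hγ f]
  ring

theorem greenKernel_mul_eq (x y : ℝ) :
    greenKernel γ x y * f y =
      (Ioi x).indicator (fun y => solJet γ 2 0 x * (dualSol γ 2 y * f y)) y -
      (Iio x).indicator (fun y => solJet γ 0 0 x * (dualSol γ 0 y * f y) +
        solJet γ 1 0 x * (dualSol γ 1 y * f y)) y := by
  have hν : -1 < -1 - γ := by linarith
  simp only [dualSol, Fin.sum_univ_three, solJet_zero_eq_genAi hγ (by linarith),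
    solJet_one_eq_genGi hγ (by linarith), solJet_two_eq_genHi, kernelMatrix,
    solJet_zero_eq_genAi hν (by linarith), solJet_one_eq_genGi hν (by linarith), greenKernel]
  rcases lt_trichotomy x y with h | rfl | h
  · simp [h, h.not_gt, indicator]
    ring
  · simp
  · simp [h, h.not_gt, indicator]
    ring

theorem integrable_greenKernel_mul (x : ℝ) : Integrable fun y => greenKernel γ x y * f y := by
  have h_int (i : Fin 3) := (integrable_dualSol_mul hγ' f i).const_mul (solJet γ i 0 x)
  simp only [greenKernel_mul_eq hγ hγ' f]
  exact ((h_int 2).indicator measurableSet_Ioi).sub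
    (((h_int 0).add (h_int 1)).indicator measurableSet_Iio)

theorem greenJet_eq_integral (x : ℝ) : greenJet γ f 0 x = ∫ y, greenKernel γ x y * f y := by
  have h_int (i : Fin 3) := (integrable_dualSol_mul hγ' f i).const_mul (solJet γ i 0 x)
  simp only [greenKernel_mul_eq hγ hγ' f]
  rw [integral_sub ((h_int 2).indicator measurableSet_Ioi)
      (((h_int 0).fun_add (h_int 1)).indicator measurableSet_Iio),
    integral_indicator measurableSet_Ioi, integral_indicator measurableSet_Iio,
    integral_add (h_int 0).integrableOn (h_int 1).integrableOn,
    integral_const_mul, integral_const_mul, integral_const_mul, ← integral_Iic_eq_integral_Iio,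
    ← integral_Iic_eq_integral_Iio]
  simp [greenJet, greenWeight, Fin.sum_univ_three]
  ring

theorem greenJet_isBigO (k : ℕ) :
    greenJet γ f k =O[cocompact ℝ] fun x => |x| ^ (-(1 + (γ + k))) := by
  have h_mul {i : Fin 3} {l : Filter ℝ}
      (h : solJet γ i k =O[l] fun x => |x| ^ (-(1 + (γ + k)))) :
      (fun x => solJet γ i k x * greenWeight γ f i x) =O[l] fun x => |x| ^ (-(1 + (γ + k))) := by
    simpa only [mul_one] using h.mul (greenWeight_isBigO_one hγ' f i l)
  have h_zero {i : Fin 3} {l : Filter ℝ} (h : ∀ᶠ x in l, greenWeight γ f i x = 0) :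
      (fun x => solJet γ i k x * greenWeight γ f i x) =O[l] fun x => |x| ^ (-(1 + (γ + k))) :=
    .of_norm_eventuallyLE <| h.mono fun x hx => by
      dsimp only
      rw [hx, mul_zero, norm_zero]
      positivity
  rw [cocompact_eq_atBot_atTop, Asymptotics.isBigO_sup]
  unfold greenJet
  refine ⟨.fun_sum fun i _ => ?_, .fun_sum fun i _ => ?_⟩ <;> by_cases hi : i = 2
  · exact hi ▸ h_mul (solJet_isBigO_atBot hγ k)
  · exact h_zero (greenWeight_eventuallyEq_zero f hi)
  · exact hi ▸ h_zero (greenWeight_two_eventuallyEq_zero f)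
  · exact h_mul (solJet_isBigO_atTop hγ hi k)

end Green

theorem exists_forall_one_add_abs_rpow_mul_le {u : ℝ → ℝ} (hu : Continuous u) {a : ℝ}
    (ha : 0 ≤ a) (h : u =O[cocompact ℝ] fun x => |x| ^ (-a)) :
    ∃ C, ∀ x, (1 + |x|) ^ a * |u x| ≤ C := by
  have h_abs : Tendsto (fun x : ℝ => |x|) (cocompact ℝ) atTop := tendsto_norm_cocompact_atTop
  have h_weight : (fun x : ℝ => (1 + |x|) ^ a) =O[cocompact ℝ] fun x => |x| ^ a :=
    .rpow ha (.of_forall abs_nonneg) <|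
      (Asymptotics.isLittleO_const_left.2 <| .inr <| tendsto_norm_atTop_atTop.comp h_abs).isBigO.add
        (Asymptotics.isBigO_refl _ _)
  have h_one : (fun x => (1 + |x|) ^ a * u x) =O[cocompact ℝ] fun _ => (1 : ℝ) := by
    refine (h_weight.mul h).trans_eventuallyEq ?_
    filter_upwards [h_abs.eventually_gt_atTop 0] with x hx
    rw [← Real.rpow_add hx, add_neg_cancel, Real.rpow_zero]
  have h_cont : Continuous fun x => (1 + |x|) ^ a * u x :=
    ((Real.continuous_rpow_const ha).comp (by fun_prop)).mul hu
  obtain ⟨C, hC⟩ := (h_cont.isBounded_range_iff_isBigO.2 h_one).exists_norm_le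
  refine ⟨C, fun x => ?_⟩
  have h_nonneg : 0 ≤ (1 + |x|) ^ a := by positivity
  simpa only [norm_mul, Real.norm_eq_abs, abs_of_nonneg h_nonneg] using hC _ (mem_range_self x)

theorem greenJet_mem_spaceX {γ : ℝ} (hγ : -1 < γ) (hγ' : γ < 0) (f : C_c(ℝ, ℝ)) :
    greenJet γ f 0 ∈ spaceX γ := by
  have h_bound (k : ℕ) := exists_forall_one_add_abs_rpow_mul_le (continuous_greenJet hγ hγ' f k)
    (by linarith [neg_one_lt_add_natCast hγ k]) (greenJet_isBigO hγ hγ' f k)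
  obtain ⟨C, hC⟩ := h_bound 0
  obtain ⟨D, hD⟩ := h_bound 1
  refine ⟨(contDiff_greenJet hγ hγ' f).of_le (by norm_num), C + D, ?_⟩
  rintro _ ⟨x, rfl⟩
  rw [← iteratedDeriv_one, iteratedDeriv_greenJet hγ hγ' f (by simp)]
  refine add_le_add ?_ ?_
  · simpa only [Nat.cast_zero, add_zero] using hC x
  · convert! hD x using 3
    push_cast
    ring

/-- The solution operator given by the kernel. -/
def greenOperator {γ : ℝ} (hγ : -1 < γ) (hγ' : γ < 0) : C_c(ℝ, ℝ) →ₗ[ℝ] spaceX γ where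
  toFun f := ⟨greenJet γ f 0, greenJet_mem_spaceX hγ hγ' f⟩
  map_add' f g := by
    ext x
    change greenJet γ (f + g) 0 x = greenJet γ f 0 x + greenJet γ g 0 x
    simp only [greenJet_eq_integral hγ hγ' _, CompactlySupportedContinuousMap.coe_add,
      Pi.add_apply, mul_add]
    exact integral_add (integrable_greenKernel_mul hγ hγ' f x)
      (integrable_greenKernel_mul hγ hγ' g x)
  map_smul' c f := by
    ext x
    change greenJet γ (c • f) 0 x = c * greenJet γ f 0 x
    simp only [greenJet_eq_integral hγ hγ' _, ← integral_const_mul,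
      CompactlySupportedContinuousMap.coe_smul, Pi.smul_apply, smul_eq_mul, mul_left_comm c]

/-! ### The weak equation -/

theorem hasDerivAt_iteratedDeriv {E : Type*} [NormedAddCommGroup E] [NormedSpace ℝ E]
    {φ : ℝ → E} {n : ℕ∞ω} (hφ : ContDiff ℝ n φ) {k : ℕ} (hk : k < n) (x : ℝ) :
    HasDerivAt (iteratedDeriv k φ) (iteratedDeriv (k + 1) φ x) x := by
  rw [iteratedDeriv_succ]
  exact (hφ.differentiable_iteratedDeriv k hk x).hasDerivAt

theorem hasCompactSupport_iteratedDeriv {E : Type*} [NormedAddCommGroup E] [NormedSpace ℝ E]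
    {φ : ℝ → E} (hφ : HasCompactSupport φ) (k : ℕ) : HasCompactSupport (iteratedDeriv k φ) := by
  induction k with
  | zero => exact iteratedDeriv_zero (f := φ) ▸ hφ
  | succ k ih => exact iteratedDeriv_succ (f := φ) ▸ ih.deriv

/-- The formal adjoint `L_γ^* φ = γ φ - x φ' + φ'''` of `L_γ`, for functions with values in any
normed space so that complex test functions are allowed. -/
def adjL {E : Type*} [NormedAddCommGroup E] [NormedSpace ℝ E] (γ : ℝ) (φ : ℝ → E) (x : ℝ) : E :=
  γ • φ x - x • deriv φ x + iteratedDeriv 3 φ x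

section AdjL

variable {E : Type*} [NormedAddCommGroup E] [NormedSpace ℝ E] {φ : ℝ → E}

theorem continuous_adjL (γ : ℝ) (hφ : ContDiff ℝ ∞ φ) : Continuous (adjL γ φ) := by
  have h_deriv : Continuous (deriv φ) := hφ.continuous_deriv (by simp)
  have h_deriv₃ : Continuous (iteratedDeriv 3 φ) :=
    hφ.continuous_iteratedDeriv 3 (WithTop.coe_le_coe.2 le_top)
  have := hφ.continuous
  unfold adjL
  fun_prop

theorem hasCompactSupport_adjL (γ : ℝ) (hφ : HasCompactSupport φ) :
    HasCompactSupport (adjL γ φ) := by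
  unfold adjL
  exact ((hφ.smul_left (f := fun _ => γ)).sub (hφ.deriv.smul_left (f := id))).add
    (hasCompactSupport_iteratedDeriv hφ 3)

theorem map_adjL {F : Type*} [NormedAddCommGroup F] [NormedSpace ℝ F] (L : E →L[ℝ] F) (γ : ℝ)
    (hφ : ContDiff ℝ 3 φ) (x : ℝ) : L (adjL γ φ x) = adjL γ (L ∘ φ) x := by
  have h (k : ℕ) (hk : k ≤ 3) : iteratedDeriv k (L ∘ φ) x = L (iteratedDeriv k φ x) := by
    rw [iteratedDeriv_eq_iteratedFDeriv, iteratedDeriv_eq_iteratedFDeriv,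
      L.iteratedFDeriv_comp_left hφ.contDiffAt (mod_cast hk)]
    rfl
  rw [adjL, adjL, map_add, map_sub, map_smul, map_smul, h 3 le_rfl, ← iteratedDeriv_one,
    ← iteratedDeriv_one, h 1 (by simp), Function.comp_apply]

end AdjL

theorem weakEqL_iff {γ : ℝ} {u f : ℝ → ℝ} :
    WeakEqL γ u f ↔ ∀ φ : ℝ → ℝ, ContDiff ℝ ∞ φ → HasCompactSupport φ →
      ∫ x, u x * adjL γ φ x = ∫ x, f x * φ x := by
  refine forall₃_congr fun φ hφ _ => ?_
  have h_adj (x : ℝ) :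
      (1 + γ) * φ x - deriv (fun t => t * φ t) x + iteratedDeriv 3 φ x = adjL γ φ x := by
    rw [deriv_fun_mul differentiableAt_fun_id (hφ.differentiable (by simp) x), deriv_id'', adjL,
      smul_eq_mul, smul_eq_mul]
    ring
  simp only [h_adj]

theorem integrable_mul_adjL {u φ : ℝ → ℝ} (γ : ℝ) (hu : Continuous u) (hφ : ContDiff ℝ ∞ φ)
    (hφ' : HasCompactSupport φ) : Integrable fun x => u x * adjL γ φ x :=
  (hu.mul (continuous_adjL γ hφ)).integrable_of_hasCompactSupport
    (hasCompactSupport_adjL γ hφ').mul_left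

theorem WeakEqL.sub {γ : ℝ} {u v f : ℝ → ℝ} (hu : Continuous u) (hv : Continuous v)
    (huf : WeakEqL γ u f) (hvf : WeakEqL γ v f) : WeakEqL γ (u - v) 0 := by
  rw [weakEqL_iff] at huf hvf ⊢
  intro φ hφ hφ'
  simp only [Pi.sub_apply, sub_mul, Pi.zero_apply, zero_mul, integral_zero]
  rw [integral_sub (integrable_mul_adjL γ hu hφ hφ') (integrable_mul_adjL γ hv hφ hφ'),
    huf φ hφ hφ', hvf φ hφ hφ', sub_self]

theorem weakEqL_opL (γ : ℝ) {u : ℝ → ℝ} (hu : ContDiff ℝ 3 u) : WeakEqL γ u (opL γ u) := by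
  rw [weakEqL_iff]
  intro φ hφ hφ'
  have hu_deriv (k : ℕ) (hk : k < 3) (x : ℝ) :
      HasDerivAt (iteratedDeriv k u) (iteratedDeriv (k + 1) u x) x :=
    hasDerivAt_iteratedDeriv hu (mod_cast hk) x
  have hφ_deriv (k : ℕ) (x : ℝ) : HasDerivAt (iteratedDeriv k φ) (iteratedDeriv (k + 1) φ x) x :=
    hasDerivAt_iteratedDeriv hφ (WithTop.coe_lt_coe.2 (WithTop.coe_lt_top k)) x
  let B (x : ℝ) : ℝ := iteratedDeriv 2 u x * φ x - deriv u x * deriv φ x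
    + u x * iteratedDeriv 2 φ x - x * u x * φ x
  have hB (x : ℝ) : HasDerivAt B (u x * adjL γ φ x - opL γ u x * φ x) x := by
    have hu₀ := hu_deriv 0 (by simp) x
    have hu₁ := hu_deriv 1 (by simp) x
    have hφ₀ := hφ_deriv 0 x
    have hφ₁ := hφ_deriv 1 x
    simp only [zero_add, iteratedDeriv_zero, iteratedDeriv_one] at hu₀ hu₁ hφ₀ hφ₁
    refine (((((hu_deriv 2 (by simp) x).fun_mul hφ₀).fun_sub (hu₁.fun_mul hφ₁)).fun_add
      (hu₀.fun_mul (hφ_deriv 2 x))).fun_sub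
        (((hasDerivAt_id x).fun_mul hu₀).fun_mul hφ₀)).congr_deriv ?_
    simp only [adjL, opL, smul_eq_mul, id_eq]
    ring
  have h_lhs := integrable_mul_adjL γ hu.continuous hφ hφ'
  have h_opL : Continuous (opL γ u) := by
    have := hu.continuous_deriv (by norm_num)
    unfold opL
    fun_prop
  have h_rhs : Integrable fun x => opL γ u x * φ x :=
    (h_opL.mul hφ.continuous).integrable_of_hasCompactSupport hφ'.mul_left
  have hB_int : Integrable B :=
    (continuous_iff_continuousAt.2 fun x => (hB x).continuousAt).integrable_of_hasCompactSupport
      (((hφ'.mul_left.sub hφ'.deriv.mul_left).add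
        (hasCompactSupport_iteratedDeriv hφ' 2).mul_left).sub hφ'.mul_left)
  have h_int := integral_eq_zero_of_hasDerivAt_of_integrable hB (h_lhs.sub h_rhs) hB_int
  rwa [integral_sub h_lhs h_rhs, sub_eq_zero] at h_int

/-! ### Schwartz test functions -/

theorem exists_cutoff_bddAbove_iteratedDeriv : ∃ χ : ℕ → ℝ → ℝ,
    (∀ n, ContDiff ℝ ∞ (χ n)) ∧ (∀ n, HasCompactSupport (χ n)) ∧
    (∀ x, ∀ᶠ n in atTop, χ n =ᶠ[𝓝 x] 1) ∧
    ∀ k, ∃ C, ∀ n x, ‖iteratedDeriv k (χ n) x‖ ≤ C := by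
  let χ : ContDiffBump (0 : ℝ) := ⟨1, 2, one_pos, one_lt_two⟩
  have h_scale (n : ℕ) : 0 < ((n : ℝ) + 1)⁻¹ := by positivity
  refine ⟨fun n x => χ (((n : ℝ) + 1)⁻¹ * x), fun n => χ.contDiff.comp (by fun_prop),
    fun n => χ.hasCompactSupport.comp_homeomorph (Homeomorph.mulLeft₀ _ (h_scale n).ne'),
    fun x => ?_, fun k => ?_⟩
  · filter_upwards [eventually_gt_atTop ⌈|x|⌉₊] with n hn
    have hx : ((n : ℝ) + 1)⁻¹ * x ∈ Metric.ball (0 : ℝ) 1 := by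
      rw [mem_ball_zero_iff, norm_mul, norm_inv, Real.norm_of_nonneg (by positivity),
        inv_mul_lt_iff₀ (by positivity), mul_one]
      exact (Nat.lt_of_ceil_lt hn).trans (lt_add_one _)
    exact (continuous_const_mul _).continuousAt.eventually (χ.eventuallyEq_one_of_mem_ball hx)
  · obtain ⟨C, hC⟩ := (hasCompactSupport_iteratedDeriv
      χ.hasCompactSupport k).exists_bound_of_continuous
      (χ.contDiff.continuous_iteratedDeriv k (n := ∞) (WithTop.coe_le_coe.2 le_top))
    refine ⟨C, fun n x => ?_⟩
    rw [iteratedDeriv_comp_const_mul (χ.contDiff.of_le le_rfl), norm_mul, norm_pow, norm_inv]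
    refine (mul_le_of_le_one_left (norm_nonneg _) (pow_le_one₀ (by positivity) ?_)).trans (hC _)
    exact inv_le_one_of_one_le₀ (by rw [Real.norm_of_nonneg] <;> linarith [n.cast_nonneg (α := ℝ)])

theorem exists_pow_mul_norm_iteratedDeriv_mul_le {ι : Type*} {χ : ι → ℝ → ℝ}
    (hχ : ∀ n, ContDiff ℝ ∞ (χ n)) (hχ_bdd : ∀ k, ∃ C, ∀ n x, ‖iteratedDeriv k (χ n) x‖ ≤ C)
    (φ : 𝓢(ℝ, ℝ)) (m k : ℕ) :
    ∃ C, ∀ n x, (1 + ‖x‖) ^ m * ‖iteratedDeriv k (χ n * ⇑φ) x‖ ≤ C := by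
  choose C hC using hχ_bdd
  have hφ (j : ℕ) : ∃ D, ∀ x, (1 + ‖x‖) ^ m * ‖iteratedDeriv j φ x‖ ≤ D := by
    simp only [← norm_iteratedFDeriv_eq_norm_iteratedDeriv]
    exact ⟨_, φ.one_add_le_sup_seminorm_apply (𝕜 := ℝ) (m := (m, j)) le_rfl le_rfl⟩
  choose D hD using hφ
  refine ⟨∑ i ∈ Finset.range (k + 1), k.choose i * C i * D (k - i), fun n x => ?_⟩
  rw [iteratedDeriv_mul ((hχ n).contDiffAt.of_le (mod_cast le_top))
    (φ.smooth k).contDiffAt]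
  refine (mul_le_mul_of_nonneg_left (norm_sum_le _ _) (by positivity)).trans ?_
  rw [Finset.mul_sum]
  refine Finset.sum_le_sum fun i _ => ?_
  have hC_nonneg : 0 ≤ C i := (norm_nonneg _).trans (hC i n x)
  rw [norm_mul, norm_mul, mul_left_comm, RCLike.norm_natCast]
  gcongr
  · exact hC i n x
  · exact hD (k - i) x

theorem exists_norm_adjL_mul_le {ι : Type*} {χ : ι → ℝ → ℝ} (γ : ℝ)
    (hχ : ∀ n, ContDiff ℝ ∞ (χ n)) (hχ_bdd : ∀ k, ∃ C, ∀ n x, ‖iteratedDeriv k (χ n) x‖ ≤ C)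
    (φ : 𝓢(ℝ, ℝ)) : ∃ C, ∀ n x, ‖adjL γ (χ n * ⇑φ) x‖ ≤ C * (1 + ‖x‖) ^ (-2 : ℝ) := by
  obtain ⟨C₀, hC₀⟩ := exists_pow_mul_norm_iteratedDeriv_mul_le hχ hχ_bdd φ 2 0
  obtain ⟨C₁, hC₁⟩ := exists_pow_mul_norm_iteratedDeriv_mul_le hχ hχ_bdd φ 3 1
  obtain ⟨C₃, hC₃⟩ := exists_pow_mul_norm_iteratedDeriv_mul_le hχ hχ_bdd φ 2 3
  refine ⟨|γ| * C₀ + C₁ + C₃, fun n x => ?_⟩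
  have hx : 0 < (1 + ‖x‖) ^ 2 := by positivity
  rw [Real.rpow_neg (by positivity), Real.rpow_two, ← div_eq_mul_inv, le_div_iff₀' hx]
  have h_adj : ‖adjL γ (χ n * ⇑φ) x‖ ≤ |γ| * ‖iteratedDeriv 0 (χ n * ⇑φ) x‖
      + (1 + ‖x‖) * ‖iteratedDeriv 1 (χ n * ⇑φ) x‖ + ‖iteratedDeriv 3 (χ n * ⇑φ) x‖ := by
    refine (norm_add_le _ _).trans (add_le_add_left ((norm_sub_le _ _).trans ?_) _)
    rw [norm_smul, norm_smul, iteratedDeriv_zero, iteratedDeriv_one, Real.norm_eq_abs γ]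
    gcongr
    linarith
  refine (mul_le_mul_of_nonneg_left h_adj hx.le).trans ?_
  linarith [mul_le_mul_of_nonneg_left (hC₀ n x) (abs_nonneg γ), hC₁ n x, hC₃ n x]

theorem WeakEqL.integral_mul_adjL_schwartz {γ : ℝ} {u : ℝ → ℝ} {M : ℝ} (hu : Continuous u)
    (hM : ∀ x, ‖u x‖ ≤ M) (h : WeakEqL γ u 0) (φ : 𝓢(ℝ, ℝ)) : ∫ x, u x * adjL γ φ x = 0 := by
  obtain ⟨χ, hχ, hχ_supp, hχ_one, hχ_bdd⟩ := exists_cutoff_bddAbove_iteratedDeriv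
  obtain ⟨C, hC⟩ := exists_norm_adjL_mul_le γ hχ hχ_bdd φ
  have h_zero (n : ℕ) : ∫ x, u x * adjL γ (χ n * ⇑φ) x = 0 := by
    simpa using weakEqL_iff.1 h (χ n * ⇑φ) ((hχ n).mul (φ.smooth ⊤)) (hχ_supp n).mul_right
  have h_lim : Tendsto (fun n => ∫ x, u x * adjL γ (χ n * ⇑φ) x) atTop
      (𝓝 (∫ x, u x * adjL γ φ x)) := by
    refine tendsto_integral_of_dominated_convergence
      (fun x => M * (C * (1 + ‖x‖) ^ (-2 : ℝ))) (fun n => ?_) ?_ (fun n => .of_forall fun x => ?_)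
      (.of_forall fun x => tendsto_nhds_of_eventually_eq ?_)
    · exact (hu.mul (continuous_adjL γ ((hχ n).mul (φ.smooth ⊤)))).aestronglyMeasurable
    · exact ((integrable_one_add_norm (by simp)).const_mul C).const_mul M
    · rw [norm_mul]
      exact mul_le_mul (hM x) (hC n x) (norm_nonneg _) ((norm_nonneg _).trans (hM x))
    · filter_upwards [hχ_one x] with n hn
      have h_eq : χ n * ⇑φ =ᶠ[𝓝 x] φ := by simpa using hn.mul (EventuallyEq.refl _ φ)
      rw [adjL, adjL, h_eq.eq_of_nhds, h_eq.deriv_eq, h_eq.iteratedDeriv_eq]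
  simpa only [h_zero, tendsto_const_nhds_iff, eq_comm] using h_lim

theorem integrable_pow_smul {E : Type*} [NormedAddCommGroup E] [NormedSpace ℝ E]
    (φ : 𝓢(ℝ, E)) (k : ℕ) : Integrable fun x : ℝ => x ^ k • φ x := by
  refine (integrable_norm_iff (by fun_prop)).1 ?_
  simpa only [norm_smul, norm_pow] using φ.integrable_pow_mul volume k

theorem integrable_adjL {E : Type*} [NormedAddCommGroup E] [NormedSpace ℝ E] (γ : ℝ)
    (φ : 𝓢(ℝ, E)) : Integrable (adjL γ φ) := by
  have h_deriv (φ : 𝓢(ℝ, E)) : deriv φ = SchwartzMap.derivCLM ℝ E φ := rfl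
  have h_deriv₃ : iteratedDeriv 3 φ =
      SchwartzMap.derivCLM ℝ E (SchwartzMap.derivCLM ℝ E (SchwartzMap.derivCLM ℝ E φ)) := by
    simp only [iteratedDeriv_succ, iteratedDeriv_zero, h_deriv]
  unfold adjL
  rw [h_deriv, h_deriv₃]
  exact ((φ.integrable.smul γ).sub
    (by simpa using integrable_pow_smul (SchwartzMap.derivCLM ℝ E φ) 1)).add
    (SchwartzMap.integrable _)

theorem WeakEqL.integral_smul_adjL_schwartz {γ : ℝ} {u : ℝ → ℝ} {M : ℝ} (hu : Continuous u)
    (hM : ∀ x, ‖u x‖ ≤ M) (h : WeakEqL γ u 0) (φ : 𝓢(ℝ, ℂ)) : ∫ x, u x • adjL γ φ x = 0 := by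
  have h_int : Integrable fun x => u x • adjL γ φ x :=
    (integrable_adjL γ φ).bdd_smul M hu.aestronglyMeasurable (.of_forall hM)
  have h_zero (L : ℂ →L[ℝ] ℝ) : L (∫ x, u x • adjL γ φ x) = 0 := by
    rw [← L.integral_comp_comm h_int]
    simp only [map_smul, map_adjL L γ (φ.smooth 3)]
    exact h.integral_mul_adjL_schwartz hu hM (SchwartzMap.postcompCLM L φ)
  exact Complex.ext (h_zero Complex.reCLM) (h_zero Complex.imCLM)

/-! ### The equation on the Fourier side -/

/-- The position operator `φ ↦ (v ↦ v φ(v))` on Schwartz functions. -/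
def position : 𝓢(ℝ, ℂ) →L[ℂ] 𝓢(ℝ, ℂ) := SchwartzMap.smulLeftCLM ℂ fun v : ℝ => (v : ℂ)

theorem position_apply (φ : 𝓢(ℝ, ℂ)) (v : ℝ) : position φ v = v * φ v :=
  SchwartzMap.smulLeftCLM_apply_apply (by fun_prop) φ v

theorem derivCLM_fourier (φ : 𝓢(ℝ, ℂ)) :
    SchwartzMap.derivCLM ℂ ℂ (𝓕 φ) = (-2 * π * Complex.I) • 𝓕 (position φ) := by
  rw [← FourierTransform.fourier_smul]
  ext x
  rw [SchwartzMap.derivCLM_apply, SchwartzMap.fourier_coe, Real.deriv_fourier φ.integrable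
    (by simpa using integrable_pow_smul φ 1), SchwartzMap.fourier_coe]
  refine congrFun (congrArg 𝓕 (funext fun v => ?_)) x
  rw [smul_eq_mul, smul_apply, position_apply, smul_eq_mul, mul_assoc]

theorem fourier_derivCLM (φ : 𝓢(ℝ, ℂ)) :
    𝓕 (SchwartzMap.derivCLM ℂ ℂ φ) = (2 * π * Complex.I) • position (𝓕 φ) := by
  ext x
  rw [SchwartzMap.fourier_coe, smul_apply, position_apply, smul_eq_mul, ← mul_assoc]
  exact congrFun (Real.fourier_deriv φ.integrable φ.differentiable
    (SchwartzMap.derivCLM ℂ ℂ φ).integrable) x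

theorem adjL_fourier {γ : ℝ} {η ζ : 𝓢(ℝ, ℂ)}
    (h : ∀ v : ℝ, (1 + γ + 8 * π ^ 3 * Complex.I * v ^ 3) * η v + v * deriv η v = v * ζ v)
    (x : ℝ) :
    (-2 * π * Complex.I) * adjL γ (𝓕 η : 𝓢(ℝ, ℂ)) x = deriv (𝓕 ζ : 𝓢(ℝ, ℂ)) x := by
  set D := SchwartzMap.derivCLM ℂ ℂ
  set c : ℂ := -2 * π * Complex.I with hc
  have h_deriv (φ : 𝓢(ℝ, ℂ)) : deriv φ = D φ := rfl
  have h_adj : adjL γ (𝓕 η : 𝓢(ℝ, ℂ)) x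
      = ((γ : ℂ) • 𝓕 η - position (D (𝓕 η)) + D (D (D (𝓕 η))) : 𝓢(ℝ, ℂ)) x := by
    simp only [adjL, iteratedDeriv_succ, iteratedDeriv_zero, h_deriv, add_apply, sub_apply,
      smul_apply, position_apply, Complex.real_smul, smul_eq_mul]
  have h_D : position (D (𝓕 η)) = -𝓕 (D (position η)) := by
    rw [derivCLM_fourier, fourier_derivCLM, map_smul, ← neg_smul]
    congr 1
    ring
  have h_D₃ : D (D (D (𝓕 η))) = c ^ 3 • 𝓕 (position (position (position η))) := by
    simp only [D, derivCLM_fourier, map_smul, smul_smul, hc]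
    congr 1
    ring
  have h_symbol : (γ : ℂ) • η + D (position η) + c ^ 3 • position (position (position η))
      = position ζ := by
    ext v
    have h_pos : D (position η) v = η v + v * deriv η v := by
      have := ((hasDerivAt_id v).ofReal_comp.mul (η.differentiableAt (x := v)).hasDerivAt).deriv
      rw [← h_deriv, funext (position_apply η)]
      simpa using! this
    have hc₃ : c ^ 3 = 8 * π ^ 3 * Complex.I := by
      rw [hc, mul_pow, Complex.I_pow_three]
      ring
    simp only [add_apply, smul_apply, position_apply, h_pos, ← h v, hc₃, smul_eq_mul]
    ring
  rw [h_adj, h_D, h_D₃, h_deriv, derivCLM_fourier, ← h_symbol, FourierTransform.fourier_add,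
    FourierTransform.fourier_add, FourierTransform.fourier_smul, FourierTransform.fourier_smul,
    sub_neg_eq_add, smul_apply, smul_eq_mul]

theorem WeakEqL.integral_fourier_deriv_mul_eq_zero {γ : ℝ} {u : ℝ → ℝ} {M : ℝ}
    (hu : ContDiff ℝ 1 u) (hM : ∀ x, ‖u x‖ ≤ M) (hu' : Integrable (deriv u)) (h : WeakEqL γ u 0)
    {η ζ : 𝓢(ℝ, ℂ)}
    (hηζ : ∀ v : ℝ, (1 + γ + 8 * π ^ 3 * Complex.I * v ^ 3) * η v + v * deriv η v = v * ζ v) :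
    ∫ v, 𝓕 (Complex.ofReal ∘ deriv u) v * ζ v = 0 := by
  have hu_meas : AEStronglyMeasurable (fun x => (u x : ℂ)) :=
    (Complex.continuous_ofReal.comp hu.continuous).aestronglyMeasurable
  have hM' (x : ℝ) : ‖(u x : ℂ)‖ ≤ M := by simpa using hM x
  have h_weak : ∫ x, (u x : ℂ) * deriv (𝓕 ζ : 𝓢(ℝ, ℂ)) x = 0 := by
    simp only [← adjL_fourier hηζ, mul_left_comm _ (-2 * π * Complex.I), integral_const_mul]
    simpa using (h.integral_smul_adjL_schwartz hu.continuous hM (𝓕 η))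
  have h_parts := integral_mul_deriv_eq_deriv_mul_of_integrable
    (fun x _ => ((hu.differentiable one_ne_zero x).hasDerivAt.ofReal_comp))
    (fun x _ => ((𝓕 ζ : 𝓢(ℝ, ℂ)).differentiableAt (x := x)).hasDerivAt)
    ((SchwartzMap.derivCLM ℂ ℂ (𝓕 ζ)).integrable.bdd_mul hu_meas (.of_forall hM'))
    (hu'.ofReal.mul_bdd (𝓕 ζ : 𝓢(ℝ, ℂ)).continuous.aestronglyMeasurable
      (.of_forall ((𝓕 ζ : 𝓢(ℝ, ℂ)).norm_le_seminorm ℝ)))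
    ((𝓕 ζ : 𝓢(ℝ, ℂ)).integrable.bdd_mul hu_meas (.of_forall hM'))
  have h_flip : ∫ v, 𝓕 (Complex.ofReal ∘ deriv u) v * ζ v
      = ∫ x, Complex.ofReal (deriv u x) * (𝓕 ζ : 𝓢(ℝ, ℂ)) x := by
    simpa using! VectorFourier.integral_fourierIntegral_smul_eq_flip (L := innerₗ ℝ)
      Real.continuous_fourierChar continuous_inner hu'.ofReal ζ.integrable
  rw [h_flip, ← neg_eq_zero]
  exact h_parts.symm.trans h_weak

/-! ### Decaying functions annihilating derivatives -/

section DuBoisReymond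

variable {E : Type*} [NormedAddCommGroup E] [NormedSpace ℝ E]

theorem contDiff_smul_of_tsupport_subset {n : ℕ∞} {ρ : ℝ → ℝ} {f : ℝ → E} {U : Set ℝ}
    (hU : IsOpen U) (hρ : ContDiff ℝ n ρ) (hf : ContDiffOn ℝ n f U) (hρU : tsupport ρ ⊆ U) :
    ContDiff ℝ n (ρ • f) := by
  refine contMDiff_iff_contDiff.1 (contMDiff_of_tsupport fun x hx => ?_)
  have hxU : x ∈ U := hρU (tsupport_smul_subset_left ρ f hx)
  exact (hρ.contDiffAt.smul (hf.contDiffAt (hU.mem_nhds hxU))).contMDiffAt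

theorem integrable_smul_of_tsupport_subset {g : ℝ → ℝ} {G : ℝ → E} {U : Set ℝ} (hU : IsOpen U)
    (hg : Continuous g) (hgc : HasCompactSupport g) (hgU : tsupport g ⊆ U)
    (hG : ContinuousOn G U) : Integrable (g • G) :=
  ((hg.continuousOn.smul hG).continuous_of_tsupport_subset hU
    ((tsupport_smul_subset_left g G).trans hgU)).integrable_of_hasCompactSupport hgc.smul_right

theorem exists_deriv_eq_sub_comp_sub {g : ℝ → ℝ} {a T : ℝ} (hg : ContDiff ℝ ∞ g)
    (hgc : HasCompactSupport g) (hga : tsupport g ⊆ Ioi a) (hT : 0 ≤ T) :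
    ∃ ρ : ℝ → ℝ, ContDiff ℝ ∞ ρ ∧ HasCompactSupport ρ ∧ tsupport ρ ⊆ Ioi a ∧
      deriv ρ = fun v => g v - g (v - T) := by
  let ρ : ℝ → ℝ := fun v => ∫ t in (v - T)..v, g t
  have h_sub (v : ℝ) : ρ v = (∫ t in 0..v, g t) - ∫ t in 0..(v - T), g t :=
    (intervalIntegral.integral_interval_sub_left (hg.continuous.intervalIntegrable _ _)
      (hg.continuous.intervalIntegrable _ _)).symm
  have h_prim (v : ℝ) : HasDerivAt (fun v => ∫ t in 0..v, g t) (g v) v :=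
    hg.continuous.integral_hasStrictDerivAt 0 v |>.hasDerivAt
  have hρ' (v : ℝ) : HasDerivAt ρ (g v - g (v - T)) v := by
    rw [funext h_sub]
    exact (h_prim v).sub ((h_prim (v - T)).comp_sub_const v T)
  have h_deriv : deriv ρ = fun v => g v - g (v - T) := funext fun v => (hρ' v).deriv
  have hK : IsCompact (tsupport g + Icc 0 T) := hgc.isCompact.add isCompact_Icc
  have hρK : Function.support ρ ⊆ tsupport g + Icc 0 T := by
    refine Function.support_subset_iff'.2 fun v hv => ?_
    refine intervalIntegral.integral_zero_ae (.of_forall fun t ht => ?_)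
    rw [uIoc_of_le (by linarith)] at ht
    by_contra hgt
    exact hv ⟨t, subset_tsupport g hgt, v - t, ⟨by linarith [ht.2], by linarith [ht.1]⟩, by ring⟩
  have hKa : tsupport g + Icc 0 T ⊆ Ioi a := by
    rintro _ ⟨t, ht, s, hs, rfl⟩
    exact lt_add_of_lt_of_nonneg (hga ht) hs.1
  refine ⟨ρ, contDiff_infty_iff_deriv.2 ⟨fun v => (hρ' v).differentiableAt, ?_⟩,
    .of_support_subset_isCompact hK hρK, (closure_minimal hρK hK.isClosed).trans hKa, h_deriv⟩
  rw [h_deriv]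
  fun_prop

variable {G : ℝ → E} {a : ℝ}

theorem tendsto_integral_smul_comp_add {g : ℝ → ℝ} (hg : Continuous g)
    (hgc : HasCompactSupport g) (hga : tsupport g ⊆ Ioi a) (hG : ContinuousOn G (Ioi a))
    (hG₀ : Tendsto G atTop (𝓝 0)) :
    Tendsto (fun T => ∫ v, g v • G (v + T)) atTop (𝓝 0) := by
  obtain ⟨R, hR⟩ : ∃ R, ∀ v ≥ R, ‖G v‖ ≤ 1 :=
    eventually_atTop.1 (hG₀.norm.eventually_le_const (by simp))
  rw [← integral_zero ℝ E]
  refine tendsto_integral_filter_of_dominated_convergence (fun v => ‖g v‖) ?_ ?_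
    (hg.integrable_of_hasCompactSupport hgc).norm (.of_forall fun v => ?_)
  · filter_upwards [eventually_ge_atTop 0] with T hT
    refine (integrable_smul_of_tsupport_subset isOpen_Ioi hg hgc hga
      (hG.comp (by fun_prop) fun v hv => ?_)).aestronglyMeasurable
    exact lt_add_of_lt_of_nonneg hv hT
  · filter_upwards [eventually_ge_atTop (R - a)] with T hT
    refine .of_forall fun v => ?_
    by_cases hv : v ∈ tsupport g
    · have hva : a < v := hga hv
      rw [norm_smul]
      exact mul_le_of_le_one_right (norm_nonneg _) (hR _ (by linarith))
    · simp [image_eq_zero_of_notMem_tsupport hv]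
  · simpa using (hG₀.comp (tendsto_atTop_add_const_left _ v tendsto_id)).const_smul (g v)

theorem eqOn_zero_of_integral_deriv_smul_eq_zero [CompleteSpace E] (hG : ContinuousOn G (Ioi a))
    (hG₀ : Tendsto G atTop (𝓝 0))
    (h : ∀ ρ : ℝ → ℝ, ContDiff ℝ ∞ ρ → HasCompactSupport ρ → tsupport ρ ⊆ Ioi a →
      ∫ v, deriv ρ v • G v = 0) :
    EqOn G 0 (Ioi a) := by
  have h_orth (g : ℝ → ℝ) (hg : ContDiff ℝ ∞ g) (hgc : HasCompactSupport g)
      (hga : tsupport g ⊆ Ioi a) : ∫ v, g v • G v = 0 := by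
    have h_translate : ∀ T ≥ 0, ∫ v, g v • G (v + T) = ∫ v, g v • G v := by
      intro T hT
      obtain ⟨ρ, hρ, hρc, hρa, hρ'⟩ := exists_deriv_eq_sub_comp_sub hg hgc hga hT
      have hi : Integrable fun v => g v • G v :=
        integrable_smul_of_tsupport_subset isOpen_Ioi hg.continuous hgc hga hG
      have hiT : Integrable fun v => g v • G (v + T) :=
        integrable_smul_of_tsupport_subset isOpen_Ioi hg.continuous hgc hga
          (hG.comp (by fun_prop) fun v hv => lt_add_of_lt_of_nonneg hv hT)
      have hiT' : Integrable fun v => g (v - T) • G v := by simpa using hiT.comp_sub_right T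
      have h_zero := h ρ hρ hρc hρa
      simp only [hρ', sub_smul, integral_sub hi hiT', sub_eq_zero] at h_zero
      rw [h_zero, ← integral_sub_right_eq_self _ T]
      simp
    exact tendsto_nhds_unique (tendsto_const_nhds.congr' <| (eventually_ge_atTop 0).mono
      fun T hT => (h_translate T hT).symm)
      (tendsto_integral_smul_comp_add hg.continuous hgc hga hG hG₀)
  have h_ae := isOpen_Ioi.ae_eq_zero_of_integral_contDiff_smul_eq_zero
    (hG.locallyIntegrableOn measurableSet_Ioi) h_orth
  exact Measure.eqOn_open_of_ae_eq ((ae_restrict_iff' measurableSet_Ioi).2 h_ae) isOpen_Ioi hG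
    continuousOn_const

end DuBoisReymond

/-! ### Uniqueness -/

/-- The reciprocal of the solution `v ^ (1 + γ) * exp (8 * π ^ 3 * I * v ^ 3 / 3)` on `0 < v` of
the first-order equation for `𝓕 u'` into which `L_γ u = 0` is transformed. -/
def integratingFactor (γ v : ℝ) : ℂ :=
  Complex.exp ((-((1 + γ) * Real.log v) : ℝ) - (8 * π ^ 3 / 3 * v ^ 3 : ℝ) * Complex.I)

variable {γ : ℝ}

theorem norm_integratingFactor (v : ℝ) :
    ‖integratingFactor γ v‖ = Real.exp (-((1 + γ) * Real.log v)) := by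
  rw [integratingFactor, Complex.norm_exp, Complex.sub_re, Complex.ofReal_re,
    Complex.re_ofReal_mul, Complex.I_re, mul_zero, sub_zero]

theorem norm_integratingFactor_le_one (hγ : -1 ≤ γ) {v : ℝ} (hv : 1 ≤ v) :
    ‖integratingFactor γ v‖ ≤ 1 := by
  rw [norm_integratingFactor, Real.exp_le_one_iff, neg_nonpos]
  exact mul_nonneg (by linarith) (Real.log_nonneg hv)

theorem contDiffOn_integratingFactor : ContDiffOn ℝ ∞ (integratingFactor γ) (Ioi 0) := by
  have h_log : ContDiffOn ℝ ∞ (fun v => -((1 + γ) * Real.log v)) (Ioi 0) :=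
    (contDiffOn_const.mul (Real.contDiffOn_log.mono fun v (hv : 0 < v) => hv.ne')).neg
  have h_cube : ContDiff ℝ ∞ fun v : ℝ => 8 * π ^ 3 / 3 * v ^ 3 := by fun_prop
  exact ((Complex.ofRealCLM.contDiff.comp_contDiffOn h_log).sub
    ((Complex.ofRealCLM.contDiff.comp h_cube).mul contDiff_const).contDiffOn).cexp

theorem hasDerivAt_integratingFactor {v : ℝ} (hv : 0 < v) :
    HasDerivAt (integratingFactor γ)
      (integratingFactor γ v * -((1 + γ) / v + 8 * π ^ 3 * Complex.I * v ^ 2)) v := by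
  have h_log : HasDerivAt (fun v => -((1 + γ) * Real.log v)) (-((1 + γ) * v⁻¹)) v :=
    ((Real.hasDerivAt_log hv.ne').const_mul (1 + γ)).neg
  have h_cube : HasDerivAt (fun v : ℝ => 8 * π ^ 3 / 3 * v ^ 3) (8 * π ^ 3 * v ^ 2) v := by
    refine ((hasDerivAt_pow 3 v).const_mul (8 * π ^ 3 / 3)).congr_deriv ?_
    push_cast
    ring
  refine (h_log.ofReal_comp.sub (h_cube.ofReal_comp.mul_const Complex.I)).cexp.congr_deriv
    (congrArg (integratingFactor γ v * ·) ?_)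
  push_cast
  ring

theorem WeakEqL.integral_deriv_smul_integratingFactor_eq_zero {u ρ : ℝ → ℝ} {M : ℝ}
    (hu : ContDiff ℝ 1 u) (hM : ∀ x, ‖u x‖ ≤ M) (hu' : Integrable (deriv u)) (h : WeakEqL γ u 0)
    (hρ : ContDiff ℝ ∞ ρ) (hρc : HasCompactSupport ρ) (hρ₀ : tsupport ρ ⊆ Ioi 0) :
    ∫ v, deriv ρ v • (integratingFactor γ v * 𝓕 (Complex.ofReal ∘ deriv u) v) = 0 := by
  have hρ' : ContDiff ℝ ∞ (deriv ρ) := (contDiff_infty_iff_deriv.1 hρ).2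
  let η : 𝓢(ℝ, ℂ) := HasCompactSupport.toSchwartzMap hρc.smul_right
    (contDiff_smul_of_tsupport_subset isOpen_Ioi hρ (contDiffOn_integratingFactor (γ := γ)) hρ₀)
  let ζ : 𝓢(ℝ, ℂ) := HasCompactSupport.toSchwartzMap hρc.deriv.smul_right
    (contDiff_smul_of_tsupport_subset isOpen_Ioi hρ'
      (contDiffOn_integratingFactor (γ := γ)) (tsupport_deriv_subset.trans hρ₀))
  have hηζ (v : ℝ) :
      (1 + γ + 8 * π ^ 3 * Complex.I * v ^ 3) * η v + v * deriv η v = v * ζ v := by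
    by_cases hv : v ∈ tsupport ρ
    · have hv₀ : 0 < v := hρ₀ hv
      have h_deriv : deriv η v = _ :=
        ((hρ.differentiable (by simp) v).hasDerivAt.smul (hasDerivAt_integratingFactor hv₀)).deriv
      rw [h_deriv]
      have hv' : (v : ℂ) ≠ 0 := mod_cast hv₀.ne'
      simp only [η, ζ, HasCompactSupport.toSchwartzMap_toFun, Pi.smul_apply', Complex.real_smul]
      field_simp
      ring
    · have hηρ : tsupport η ⊆ tsupport ρ := tsupport_smul_subset_left ρ _
      rw [image_eq_zero_of_notMem_tsupport fun h => hv (hηρ h),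
        deriv_of_notMem_tsupport fun h => hv (hηρ h)]
      simp [ζ, deriv_of_notMem_tsupport hv]
  rw [← h.integral_fourier_deriv_mul_eq_zero hu hM hu' hηζ]
  congr with v
  simp only [ζ, HasCompactSupport.toSchwartzMap_toFun, Pi.smul_apply', Complex.real_smul]
  ring

theorem continuous_fourier_of_integrable {E : Type*} [NormedAddCommGroup E] [NormedSpace ℂ E]
    {f : ℝ → E} (hf : Integrable f) : Continuous (𝓕 f) :=
  VectorFourier.fourierIntegral_continuous Real.continuous_fourierChar (innerSL ℝ).continuous₂ hf

theorem WeakEqL.fourier_deriv_eq_zero_of_pos {u : ℝ → ℝ} {M : ℝ} (hγ : -1 ≤ γ)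
    (hu : ContDiff ℝ 1 u) (hM : ∀ x, ‖u x‖ ≤ M) (hu' : Integrable (deriv u)) (h : WeakEqL γ u 0)
    {v : ℝ} (hv : 0 < v) : 𝓕 (Complex.ofReal ∘ deriv u) v = 0 := by
  have h_cont : ContinuousOn
      (fun v => integratingFactor γ v * 𝓕 (Complex.ofReal ∘ deriv u) v) (Ioi 0) :=
    contDiffOn_integratingFactor.continuousOn.mul
      (continuous_fourier_of_integrable hu'.ofReal).continuousOn
  have h_lim : Tendsto (fun v => integratingFactor γ v * 𝓕 (Complex.ofReal ∘ deriv u) v)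
      atTop (𝓝 0) := by
    refine squeeze_zero_norm' ((eventually_ge_atTop 1).mono fun v hv => ?_)
      (tendsto_zero_iff_norm_tendsto_zero.1
        ((Real.zero_at_infty_fourier (Complex.ofReal ∘ deriv u)).mono_left atTop_le_cocompact))
    rw [norm_mul]
    exact mul_le_of_le_one_left (norm_nonneg _) (norm_integratingFactor_le_one hγ hv)
  have h_zero := eqOn_zero_of_integral_deriv_smul_eq_zero h_cont h_lim
    (fun ρ => h.integral_deriv_smul_integratingFactor_eq_zero hu hM hu') hv
  exact (mul_eq_zero.1 h_zero).resolve_left (Complex.exp_ne_zero _)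

theorem fourier_ofReal_neg (w : ℝ → ℝ) (v : ℝ) :
    𝓕 (Complex.ofReal ∘ w) (-v) = starRingEnd ℂ (𝓕 (Complex.ofReal ∘ w) v) := by
  simp only [Real.fourier_real_eq_integral_exp_smul, ← integral_conj, Function.comp_apply,
    smul_eq_mul, map_mul, ← Complex.exp_conj, Complex.conj_ofReal, Complex.conj_I]
  congr with x
  congr 2
  push_cast
  ring

theorem WeakEqL.eq_zero {u : ℝ → ℝ} (hγ : -1 ≤ γ) (hu : ContDiff ℝ 1 u)
    (hu₀ : Tendsto u (cocompact ℝ) (𝓝 0)) (hu' : Integrable (deriv u)) (h : WeakEqL γ u 0) :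
    u = 0 := by
  obtain ⟨M, hM⟩ := (ZeroAtInftyContinuousMap.mk ⟨u, hu.continuous⟩ hu₀).isBounded_range
    |>.exists_norm_le
  have hM' (x : ℝ) : ‖u x‖ ≤ M := hM _ ⟨x, rfl⟩
  have h_cont : Continuous (Complex.ofReal ∘ deriv u) :=
    Complex.continuous_ofReal.comp (hu.continuous_deriv le_rfl)
  have h_fourier : 𝓕 (Complex.ofReal ∘ deriv u) = 0 := by
    refine (continuous_fourier_of_integrable hu'.ofReal).ext_on (dense_compl_singleton 0)
      continuous_const fun v hv => ?_
    rcases lt_or_gt_of_ne hv with hv | hv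
    · simpa only [neg_neg, h.fourier_deriv_eq_zero_of_pos hγ hu hM' hu' (neg_pos.2 hv), map_zero,
        Pi.zero_apply] using fourier_ofReal_neg (deriv u) (-v)
    · exact h.fourier_deriv_eq_zero_of_pos hγ hu hM' hu' hv
  have h_deriv (x : ℝ) : deriv u x = 0 := by
    have h_inv := congrFun (h_cont.fourierInv_fourier_eq hu'.ofReal
      (h_fourier ▸ integrable_zero _ _ _)) x
    rw [h_fourier, Real.fourierInv_eq'] at h_inv
    simpa using h_inv.symm
  funext x
  exact tendsto_nhds_unique
    (tendsto_const_nhds.congr (is_const_of_deriv_eq_zero (hu.differentiable one_ne_zero) h_deriv x))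
    hu₀

theorem eq_zero_of_mem_spaceX_of_weakEqL {u : ℝ → ℝ} (hγ : -1 < γ) (hu : u ∈ spaceX γ)
    (h : WeakEqL γ u 0) : u = 0 := by
  obtain ⟨hu_contDiff, D, hD⟩ := hu
  have h_le (x : ℝ) : (1 + |x|) ^ (1 + γ) * |u x| + (1 + |x|) ^ (2 + γ) * |deriv u x| ≤ D :=
    hD ⟨x, rfl⟩
  have hu_le (x : ℝ) : ‖u x‖ ≤ D * (1 + |x|) ^ (-(1 + γ)) := by
    rw [Real.rpow_neg (by positivity), ← div_eq_mul_inv, le_div_iff₀' (by positivity)]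
    exact le_of_add_le_of_nonneg_left (h_le x) (by positivity)
  have hu'_le (x : ℝ) : ‖deriv u x‖ ≤ D * (1 + |x|) ^ (-(2 + γ)) := by
    rw [Real.rpow_neg (by positivity), ← div_eq_mul_inv, le_div_iff₀' (by positivity)]
    exact le_of_add_le_of_nonneg_right (h_le x) (by positivity)
  have h_weight : Tendsto (fun x : ℝ => 1 + |x|) (cocompact ℝ) atTop :=
    tendsto_atTop_add_const_left _ _ (tendsto_norm_cocompact_atTop (E := ℝ))
  have hu₀ : Tendsto u (cocompact ℝ) (𝓝 0) := squeeze_zero_norm hu_le <| by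
    simpa using ((tendsto_rpow_neg_atTop (y := 1 + γ) (by linarith)).comp h_weight).const_mul D
  have h_rpow : Integrable fun x : ℝ => (1 + |x|) ^ (-(2 + γ)) :=
    integrable_one_add_norm (E := ℝ) (by rw [Module.finrank_self]; push_cast; linarith)
  exact h.eq_zero hγ.le hu_contDiff hu₀ ((h_rpow.const_mul D).mono'
    (hu_contDiff.continuous_deriv le_rfl).aestronglyMeasurable (.of_forall hu'_le))

theorem eq_of_mem_spaceX_of_weakEqL {f : ℝ → ℝ} {u v : spaceX γ} (hγ : -1 < γ)
    (hu : WeakEqL γ u f) (hv : WeakEqL γ v f) : u = v :=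
  Subtype.ext <| sub_eq_zero.1 <| eq_zero_of_mem_spaceX_of_weakEqL hγ (u - v).2 <|
    hu.sub u.2.1.continuous v.2.1.continuous hv

end

theorem theorem5p1 (γ : ℝ) (hγ : -1 < γ) (hγ' : γ < 0) :
    ∃ T : C_c(ℝ, ℝ) →ₗ[ℝ] spaceX γ,
      IsRightInverseL γ T ∧
      (∀ f : C_c(ℝ, ℝ), ContDiff ℝ 3 (T f : ℝ → ℝ) ∧ ∀ x, opL γ (T f : ℝ → ℝ) x = f x) ∧
      (∀ (f : C_c(ℝ, ℝ)) (x : ℝ), Integrable (fun y => greenKernel γ x y * f y) ∧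
        (T f : ℝ → ℝ) x = ∫ y, greenKernel γ x y * f y) ∧
      (∀ S : C_c(ℝ, ℝ) → spaceX γ, IsRightInverseL γ S → S = T) := by
  have hT : IsRightInverseL γ (greenOperator hγ hγ') := fun f => by
    have h := weakEqL_opL γ (contDiff_greenJet hγ hγ' f)
    rwa [opL_greenJet hγ hγ' f] at h
  refine ⟨greenOperator hγ hγ', hT, fun f => ⟨contDiff_greenJet hγ hγ' f, fun x => ?_⟩,
    fun f x => ⟨integrable_greenKernel_mul hγ hγ' f x, greenJet_eq_integral hγ hγ' f x⟩,
    fun S hS => funext fun f => eq_of_mem_spaceX_of_weakEqL hγ (hS f) (hT f)⟩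
  exact congrFun (opL_greenJet hγ hγ' f) x
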